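/- **Setting.** Let $F:\mathbb{R}^n\to\mathbb{R}^n$ be continuously differentiable, let $g_1,\dots,g_m:\mathbb{R}^n\to\mathbb{R}$ be convex and continuously differentiable with locally Lipschitz gradients (for instance, convex and $C^2$), let $h(x)=Hx-c$ with $H\in\mathbb{R}^{k\times n}$, $c\in\mathbb{R}^k$, and let $$\mathcal{C}=\{x\in\mathbb{R}^n : g(x)\le 0,\ h(x)=0\},$$ which is a closed convex set. Let $\mathrm{SOL}(F,\mathcal{C})$ be the set of $x^*\in\mathcal{C}$ with $(x-x^*)^\top F(x^*)\ge 0$ for all $x\in\mathcal{C}$, and write $I_0(x)=\{i : g_i(x)=0\}$. *MFCQ* holds at $x\in\mathcal{C}$ if $\nabla h_1(x),\dots,\nabla h_k(x)$ are linearly independent and there is $\xi\in\mathbb{R}^n$ with $\nabla g_i(x)^\top\xi<0$ for all $i\in I_0(x)$ and $\nabla h_j(x)^\top\xi=0$ for all $j$. The *constant-rank condition* holds at $x\in\mathcal{C}$ if there is an open set $U\ni x$ such that for every $I\subset I_0(x)$ the rank of $\{\nabla g_i(y)\}_{i\in I}\cup\{\nabla h_j(y)\}_{j=1}^k$ is constant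 for $y\in U$. Fix $\alpha>0$. For $x\in\mathbb{R}^n$ put $\mathcal{F}(x,u,v)=-F(x)-\sum_i u_i\nabla g_i(x)-\sum_j v_j\nabla h_j(x)$, let $K_\alpha(x)$ be the set of $(u,v)\in\mathbb{R}^m_{\ge0}\times\mathbb{R}^k$ such that $\xi=\mathcal{F}(x,u,v)$ satisfies $\nabla g_i(x)^\top\xi\le-\alpha g_i(x)$ for all $i$ and $\nabla h_j(x)^\top\xi=-\alpha h_j(x)$ for all $j$. The *safe monotone flow* with parameter $\alpha$ is the system $\dot x=\mathcal{F}(x,u,v)$, where $(u,v)$ is any minimizer of $\tfrac12\|\sum_i u_i\nabla g_i(x)+\sum_j v_j\nabla h_j(x)\|^2$ over $K_\alpha(x)$. An equilibrium $x^*$ of this system is *globally Lyapunov stable* if solutions of the system exist from every initial point of $\mathbb{R}^n$ and every solution on an interval $[0,T)$ extends to $[0,\infty)$; for every $\varepsilon>0$ there is $\delta>0$ such that every solution with $\|x(0)-x^*\|<\delta$ satisfies $\|x(t)-x^*\|<\varepsilon$ for all $t\ge0$; and for every $r$ there is $R$ such that every solution with $\|x(0)-x^*\|\le r$ satisfies $\|x(t)-x^*\|\le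 R$ for all $t\ge0$. It is *globally asymptotically stable* if, in addition, every solution on $[0,\infty)$ converges to $x^*$ as $t\to\infty$. **Theorem (Stability of the safe monotone flow with respect to $\mathbb{R}^n$).** Assume that MFCQ and the constant-rank condition hold at every point of $\mathcal{C}$, and let $\alpha>0$. 1. If $x^*\in\mathrm{SOL}(F,\mathcal{C})$ and $F$ is monotone, i.e. $(x_1-x_2)^\top(F(x_1)-F(x_2))\ge0$ for all $x_1,x_2\in\mathbb{R}^n$, then $x^*$ is a globally Lyapunov stable equilibrium of the safe monotone flow. 2. If $x^*\in\mathrm{SOL}(F,\mathcal{C})$ and $F$ is $\mu$-strongly monotone for some $\mu>0$, i.e. $(x_1-x_2)^\top(F(x_1)-F(x_2))\ge\mu\|x_1-x_2\|^2$ for all $x_1,x_2\in\mathbb{R}^n$, then $x^*$ is a globally asymptotically stable equilibrium of the safe monotone flow. -/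

import Mathlib

open Set Filter Topology

noncomputable section

namespace SafeMonotone

/-- `ℝⁿ` with the Euclidean norm. -/
abbrev Vec (n : ℕ) := EuclideanSpace ℝ (Fin n)

variable {n m k : ℕ}

/-! ### Monotone maps, constraints and variational inequalities -/

/-- `F` is monotone: `(x₁ - x₂)ᵀ (F x₁ - F x₂) ≥ 0`. -/
def IsMonotoneMap (F : Vec n → Vec n) : Prop :=
  ∀ x₁ x₂, 0 ≤ inner ℝ (x₁ - x₂) (F x₁ - F x₂)

/-- `F` is `μ`-strongly monotone: `(x₁ - x₂)ᵀ (F x₁ - F x₂) ≥ μ ‖x₁ - x₂‖²`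
(used with `μ > 0`). -/
def IsStronglyMonotoneMap (μ : ℝ) (F : Vec n → Vec n) : Prop :=
  ∀ x₁ x₂, μ * ‖x₁ - x₂‖ ^ 2 ≤ inner ℝ (x₁ - x₂) (F x₁ - F x₂)

/-- The affine equality constraint functions `h(x) = H x - c`, component by component. -/
def affineConstraint (H : Matrix (Fin k) (Fin n) ℝ) (c : Fin k → ℝ) (j : Fin k) (x : Vec n) : ℝ :=
  (∑ l, H j l * x l) - c j

/-- The constraint set `𝒞 = {x | g(x) ≤ 0, h(x) = 0}`. -/
def constraintSet (g : Fin m → Vec n → ℝ) (h : Fin k → Vec n → ℝ) : Set (Vec n) :=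
  {x | (∀ i, g i x ≤ 0) ∧ ∀ j, h j x = 0}

/-- The solution set of the variational inequality `VI(F, C)`: points `z ∈ C` with
`(x - z)ᵀ F(z) ≥ 0` for all `x ∈ C`. -/
def SOL (F : Vec n → Vec n) (C : Set (Vec n)) : Set (Vec n) :=
  {z | z ∈ C ∧ ∀ x ∈ C, 0 ≤ inner ℝ (x - z) (F z)}

/-- The active inequality constraints at `x`. -/
def activeSet (g : Fin m → Vec n → ℝ) (x : Vec n) : Set (Fin m) :=
  {i | g i x = 0}

/-- The Mangasarian-Fromovitz constraint qualification at `x`. -/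
def MFCQ (g : Fin m → Vec n → ℝ) (h : Fin k → Vec n → ℝ) (x : Vec n) : Prop :=
  LinearIndependent ℝ (fun j => gradient (h j) x) ∧
    ∃ ξ : Vec n, (∀ i ∈ activeSet g x, inner ℝ (gradient (g i) x) ξ < 0) ∧
      ∀ j, inner ℝ (gradient (h j) x) ξ = 0

/-- The rank of the family `{∇ gᵢ(y)}_{i ∈ I} ∪ {∇ hⱼ(y)}_j`. -/
def gradientRank (g : Fin m → Vec n → ℝ) (h : Fin k → Vec n → ℝ) (I : Set (Fin m))
    (y : Vec n) : ℕ :=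
  Module.finrank ℝ (Submodule.span ℝ
    ((fun i => gradient (g i) y) '' I ∪ Set.range fun j => gradient (h j) y))

/-- The constant-rank condition at `x`: on some open set `U` containing `x`, for every set `I` of
constraints active at `x`, the rank of `{∇ gᵢ(y)}_{i ∈ I} ∪ {∇ hⱼ(y)}_j` does not depend on
`y ∈ U`. -/
def ConstantRank (g : Fin m → Vec n → ℝ) (h : Fin k → Vec n → ℝ) (x : Vec n) : Prop :=
  ∃ U : Set (Vec n), IsOpen U ∧ x ∈ U ∧
    ∀ I ⊆ activeSet g x, ∀ y ∈ U, gradientRank g h I y = gradientRank g h I x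

/-! ### The safe monotone flow -/

/-- The modification `∑ᵢ uᵢ ∇gᵢ(x) + ∑ⱼ vⱼ ∇hⱼ(x)` of the drift by the inputs `(u, v)`. -/
def inputTerm (g : Fin m → Vec n → ℝ) (h : Fin k → Vec n → ℝ) (x : Vec n)
    (u : Fin m → ℝ) (v : Fin k → ℝ) : Vec n :=
  (∑ i, u i • gradient (g i) x) + ∑ j, v j • gradient (h j) x

/-- The control-affine system `-F(x) - ∑ᵢ uᵢ ∇gᵢ(x) - ∑ⱼ vⱼ ∇hⱼ(x)`. -/
def controlField (F : Vec n → Vec n) (g : Fin m → Vec n → ℝ) (h : Fin k → Vec n → ℝ)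
    (x : Vec n) (u : Fin m → ℝ) (v : Fin k → ℝ) : Vec n :=
  -F x - inputTerm g h x u v

/-- The set of inputs `u ≥ 0`, `v`, for which the controlled velocity `ξ` satisfies
`∇gᵢ(x)ᵀ ξ ≤ -α gᵢ(x)` and `∇hⱼ(x)ᵀ ξ = -α hⱼ(x)`. -/
def Kcbf (F : Vec n → Vec n) (g : Fin m → Vec n → ℝ) (h : Fin k → Vec n → ℝ) (α : ℝ)
    (x : Vec n) : Set ((Fin m → ℝ) × (Fin k → ℝ)) :=
  {p | (∀ i, 0 ≤ p.1 i) ∧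
    (∀ i, inner ℝ (gradient (g i) x) (controlField F g h x p.1 p.2) ≤ -α * g i x) ∧
    ∀ j, inner ℝ (gradient (h j) x) (controlField F g h x p.1 p.2) = -α * h j x}

/-- The objective `J(x, u, v) = ½ ‖∑ᵢ uᵢ ∇gᵢ(x) + ∑ⱼ vⱼ ∇hⱼ(x)‖²`. -/
def inputCost (g : Fin m → Vec n → ℝ) (h : Fin k → Vec n → ℝ) (x : Vec n)
    (p : (Fin m → ℝ) × (Fin k → ℝ)) : ℝ :=
  (1 / 2) * ‖inputTerm g h x p.1 p.2‖ ^ 2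

/-- The safe monotone flow with safety parameter `α`: the velocities at `x` of the control system
closed with a minimizer of `J(x, ·)` over `Kcbf`. The minimizing input need not be unique, so this
is written as a set of velocities; no uniqueness is presupposed. -/
def safeMonotoneFlow (F : Vec n → Vec n) (g : Fin m → Vec n → ℝ) (h : Fin k → Vec n → ℝ) (α : ℝ)
    (x : Vec n) : Set (Vec n) :=
  {ξ | ∃ p ∈ Kcbf F g h α x, IsMinOn (inputCost g h x) (Kcbf F g h α x) p ∧
    ξ = controlField F g h x p.1 p.2}

/-! ### Trajectories and stability -/

/-- `x` solves `ẋ ∈ G(x)` on the set of times `S` (an interval `[0, T)` or `[0, ∞)` below). -/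
def IsSolutionOn (G : Vec n → Set (Vec n)) (x : ℝ → Vec n) (S : Set ℝ) : Prop :=
  ∀ t ∈ S, ∃ ξ ∈ G (x t), HasDerivWithinAt x ξ S t

/-- From every initial state of `ℝⁿ` there is a solution defined for all `t ≥ 0`, and every
solution on a bounded interval `[0, T)` extends to all `t ≥ 0`. -/
def ForwardComplete (G : Vec n → Set (Vec n)) : Prop :=
  (∀ x₀, ∃ x, IsSolutionOn G x (Ici 0) ∧ x 0 = x₀) ∧
    ∀ T > 0, ∀ x, IsSolutionOn G x (Ico 0 T) →
      ∃ y, IsSolutionOn G y (Ici 0) ∧ EqOn y x (Ico 0 T)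

/-- Lyapunov stability of `p`, required of all solutions. -/
def LyapunovStable (G : Vec n → Set (Vec n)) (p : Vec n) : Prop :=
  ∀ ε > 0, ∃ δ > 0, ∀ T > 0, ∀ x, IsSolutionOn G x (Ico 0 T) →
    ‖x 0 - p‖ < δ → ∀ t ∈ Ico 0 T, ‖x t - p‖ < ε

/-- Solutions starting in a given ball around `p` stay in a common ball around `p`. -/
def SolutionsBounded (G : Vec n → Set (Vec n)) (p : Vec n) : Prop :=
  ∀ r : ℝ, ∃ R : ℝ, ∀ T > 0, ∀ x, IsSolutionOn G x (Ico 0 T) →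
    ‖x 0 - p‖ ≤ r → ∀ t ∈ Ico 0 T, ‖x t - p‖ ≤ R

/-- Global Lyapunov stability (with respect to the whole of `ℝⁿ`) of the equilibrium `p`. -/
def GloballyLyapunovStable (G : Vec n → Set (Vec n)) (p : Vec n) : Prop :=
  0 ∈ G p ∧ ForwardComplete G ∧ LyapunovStable G p ∧ SolutionsBounded G p

/-- Global asymptotic stability (with respect to the whole of `ℝⁿ`) of the equilibrium `p`. -/
def GloballyAsymptoticallyStable (G : Vec n → Set (Vec n)) (p : Vec n) : Prop :=
  GloballyLyapunovStable G p ∧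
    ∀ x, IsSolutionOn G x (Ici 0) → Tendsto x atTop (𝓝 p)

end SafeMonotone

/-!
Slater's condition makes the set of feasible velocities depend on `x` in a continuous way, so the
velocity `ξ(x)` of the flow, which is the feasible velocity nearest to `-F(x)`, is continuous. It
need not be locally Lipschitz, hence solutions come from Peano's theorem, and bounded solutions
extend.

For `p` in `SOL F 𝒞` with multipliers `(u, v)`, put `W(x) = min (F(x)ᵀ ζ + ½ ‖ζ‖²)` over the
feasible velocities `ζ` at `x`, and `L(x) = uᵀ g(x) + vᵀ h(x)`. Then
`V(x) = ½ ‖x - p‖² + max (-W(x)) 0 / α² + max (L(x)) 0 / α`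
satisfies `V̇ ≤ -(x - p)ᵀ (F(x) - F(p))` along the flow, with `V̇` an upper right Dini derivative.
The delicate term is `-W`. By duality it is dominated by
`½ ‖F(y) + ∑ᵢ uᵢ ∇gᵢ(y) + ∑ⱼ vⱼ ∇hⱼ(y)‖² - α (uᵀ g(y) + vᵀ h(y))` for every `u ≥ 0` and `v`, with
equality at `y = x` for the multipliers of `ξ(x)`. With these multipliers fixed, the flow moves
against the monotone map in the norm, so that the first summand does not increase to first order.
-/

open Asymptotics

noncomputable section

namespace SafeMonotone

section DiniDerivative

/-- The upper right Dini derivative of `f` at `t` is at most `a`. Energies along a flow that is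
only continuous are controlled through this notion, as they need not be differentiable. -/
def UpperRightDerivLE (f : ℝ → ℝ) (t a : ℝ) : Prop :=
  ∀ ε > 0, ∀ᶠ s in 𝓝[>] t, f s ≤ f t + (a + ε) * (s - t)

namespace UpperRightDerivLE

variable {f g φ : ℝ → ℝ} {t a b c : ℝ}

lemma mono (hf : UpperRightDerivLE f t a) (hab : a ≤ b) : UpperRightDerivLE f t b := by
  intro ε hε
  filter_upwards [hf ε hε, self_mem_nhdsWithin] with s hs (hts : t < s)
  have : 0 ≤ (b - a) * (s - t) := mul_nonneg (sub_nonneg.2 hab) (sub_nonneg.2 hts.le)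
  linarith

lemma of_hasDerivWithinAt (hf : HasDerivWithinAt f a (Ioi t) t) : UpperRightDerivLE f t a := by
  intro ε hε
  have hslope := (hasDerivWithinAt_iff_tendsto_slope' self_notMem_Ioi).1 hf
  filter_upwards [hslope.eventually_lt_const (lt_add_of_pos_right a hε), self_mem_nhdsWithin]
    with s hs (hts : t < s)
  rw [slope_def_field, div_lt_iff₀ (sub_pos.2 hts)] at hs
  linarith

lemma of_mul_sub_le_isLittleO {ρ : ℝ → ℝ} (hρ : ρ =o[𝓝[>] t] fun s => (s - t) ^ 2)
    (hle : ∀ᶠ s in 𝓝[>] t, (s - t) * (f s - f t) ≤ ρ s) : UpperRightDerivLE f t 0 := by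
  intro ε hε
  filter_upwards [hρ.bound hε, hle, self_mem_nhdsWithin] with s hρs hs (hts : t < s)
  have hpos : 0 < s - t := sub_pos.2 hts
  rw [Real.norm_eq_abs, Real.norm_of_nonneg (sq_nonneg (s - t))] at hρs
  have hmul : (s - t) * (f s - f t) ≤ (s - t) * (ε * (s - t)) := by
    linarith [le_abs_self (ρ s)]
  linarith [le_of_mul_le_mul_left hmul hpos]

lemma of_le_of_eq (hφ : UpperRightDerivLE φ t a) (hle : ∀ s, f s ≤ φ s) (heq : f t = φ t) :
    UpperRightDerivLE f t a := by
  intro ε hε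
  filter_upwards [hφ ε hε] with s hs
  exact heq ▸ (hle s).trans hs

lemma add (hf : UpperRightDerivLE f t a) (hg : UpperRightDerivLE g t b) :
    UpperRightDerivLE (fun s => f s + g s) t (a + b) := by
  intro ε hε
  filter_upwards [hf (ε / 2) (half_pos hε), hg (ε / 2) (half_pos hε)] with s hfs hgs
  linarith

lemma const_mul (hf : UpperRightDerivLE f t a) (hc : 0 < c) :
    UpperRightDerivLE (fun s => c * f s) t (c * a) := by
  intro ε hε
  filter_upwards [hf (ε / c) (div_pos hε hc)] with s hs
  calc c * f s ≤ c * (f t + (a + ε / c) * (s - t)) := mul_le_mul_of_nonneg_left hs hc.le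
    _ = c * f t + (c * a + ε) * (s - t) := by field_simp

protected lemma max (hfc : ContinuousWithinAt f (Ioi t) t) (hgc : ContinuousWithinAt g (Ioi t) t)
    (hf : g t ≤ f t → UpperRightDerivLE f t a) (hg : f t ≤ g t → UpperRightDerivLE g t a) :
    UpperRightDerivLE (fun s => max (f s) (g s)) t a := by
  intro ε hε
  rcases lt_trichotomy (f t) (g t) with hlt | heq | hlt
  · filter_upwards [hfc.eventually_lt hgc hlt, hg hlt.le ε hε] with s hs hgs
    simpa only [max_eq_right hlt.le, max_eq_right hs.le] using hgs
  · filter_upwards [hf heq.ge ε hε, hg heq.le ε hε] with s hfs hgs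
    rw [← heq] at hgs
    simpa only [← heq, max_self] using max_le hfs hgs
  · filter_upwards [hgc.eventually_lt hfc hlt, hf hlt.le ε hε] with s hs hfs
    simpa only [max_eq_left hlt.le, max_eq_left hs.le] using hfs

lemma le_add_mul_sub (hab : a ≤ b) (hf : ContinuousOn f (Icc a b))
    (hc : ∀ t ∈ Ico a b, UpperRightDerivLE f t c) : f b ≤ f a + c * (b - a) := by
  refine image_le_of_liminf_slope_right_le_deriv_boundary (f := f)
    (B := fun t => f a + c * (t - a)) (B' := fun _ => c) hf (by simp) (by fun_prop)
    (fun t _ => ?_) (fun t ht r hr => Eventually.frequently ?_) (right_mem_Icc.2 hab)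
  · simpa using (((hasDerivWithinAt_id t (Ici t)).sub_const a).const_mul c).const_add (f a)
  · filter_upwards [hc t ht ((r - c) / 2) (half_pos (sub_pos.2 hr)), self_mem_nhdsWithin]
      with s hs (hts : t < s)
    have hpos : 0 < s - t := sub_pos.2 hts
    rw [slope_def_field, div_lt_iff₀ hpos]
    nlinarith

variable {E : Type*} [NormedAddCommGroup E] [InnerProductSpace ℝ E] {N : E → E} {x : ℝ → E}

/-- Monotonicity forces the increment of `N` along the curve to point against its velocity
`-N (x t)` up to a term of second order. -/
lemma norm_sq_of_monotone (hN : ∀ y z, 0 ≤ inner ℝ (y - z) (N y - N z))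
    (hLip : LocallyLipschitz N) (hx : HasDerivWithinAt x (-N (x t)) (Ioi t) t) :
    UpperRightDerivLE (fun s => ‖N (x s)‖ ^ 2) t 0 := by
  obtain ⟨K, U, hU, hLip⟩ := hLip (x t)
  set r : ℝ → E := fun s => x s - x t - (s - t) • -N (x t) with hr_def
  set d : ℝ → E := fun s => N (x s) - N (x t) with hd_def
  have hr : r =o[𝓝[>] t] fun s => s - t := hasDerivWithinAt_iff_isLittleO.1 hx
  have hd : d =O[𝓝[>] t] fun s => s - t := by
    refine IsBigO.trans (IsBigO.of_bound K ?_) hx.hasFDerivWithinAt.isBigO_sub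
    filter_upwards [hx.continuousWithinAt hU] with s hs
    exact hLip.norm_sub_le hs (mem_of_mem_nhds hU)
  have hsub : (fun s => s - t) =o[𝓝[>] t] fun _ => (1 : ℝ) :=
    (isLittleO_one_iff ℝ).2 (tendsto_nhdsWithin_of_tendsto_nhds (by
      simpa using (continuous_sub_right t).tendsto t))
  have hdd : (fun s => (s - t) * (‖d s‖ * ‖d s‖)) =o[𝓝[>] t] fun s => (s - t) * (s - t) := by
    simpa only [one_mul] using hsub.mul_isBigO (hd.norm_left.mul hd.norm_left)
  have hρ : (fun s => 2 * (‖r s‖ * ‖d s‖) + (s - t) * (‖d s‖ * ‖d s‖))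
      =o[𝓝[>] t] fun s => (s - t) ^ 2 := by
    simpa only [sq] using ((hr.norm_left.mul_isBigO hd.norm_left).const_mul_left 2).add hdd
  refine of_mul_sub_le_isLittleO hρ (Eventually.of_forall fun s => ?_)
  have hexpand : ‖N (x s)‖ ^ 2 = ‖N (x t)‖ ^ 2 + 2 * inner ℝ (N (x t)) (d s) + ‖d s‖ ^ 2 := by
    rw [← norm_add_sq_real, hd_def, add_sub_cancel]
  have hinner : inner ℝ (r s) (d s)
      = inner ℝ (x s - x t) (d s) + (s - t) * inner ℝ (N (x t)) (d s) := by
    simp only [hr_def, smul_neg, sub_neg_eq_add, inner_add_left, real_inner_smul_left]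
  linear_combination 2 * real_inner_le_norm (r s) (d s) + 2 * hN (x s) (x t)
    + (s - t) * hexpand - 2 * hinner

end UpperRightDerivLE

end DiniDerivative

section Peano

variable {E : Type*} [NormedAddCommGroup E] [NormedSpace ℝ E]

/-- The Euler scheme of `ẋ = G x` from `x₀`, with `ν` steps per unit of time. -/
def eulerSeq (G : E → E) (x₀ : E) (ν : ℝ) : ℕ → E
  | 0 => x₀
  | k + 1 => eulerSeq G x₀ ν k + (1 / ν) • G (eulerSeq G x₀ ν k)

/-- The state of the Euler scheme with `ν` steps per unit of time at time `t`, as a step function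
of `t`. -/
def eulerCurve (G : E → E) (x₀ : E) (ν t : ℝ) : E :=
  eulerSeq G x₀ ν ⌊t * ν⌋₊

variable {G : E → E} {x₀ e : E} {x : ℝ → E} {ν M ε : ℝ} {𝓕 : Filter ℝ}

lemma norm_eulerSeq_sub_sub_smul_le (hν : 0 ≤ ν) {k l : ℕ} (hkl : k ≤ l)
    (hG : ∀ i, k ≤ i → i < l → ‖G (eulerSeq G x₀ ν i) - e‖ ≤ ε) :
    ‖eulerSeq G x₀ ν l - eulerSeq G x₀ ν k - (l / ν - k / ν) • e‖ ≤ ε * (l / ν - k / ν) := by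
  induction l, hkl using Nat.le_induction with
  | base => simp
  | succ l hkl ih =>
    have hstep : ‖(1 / ν) • (G (eulerSeq G x₀ ν l) - e)‖ ≤ 1 / ν * ε := by
      rw [norm_smul, Real.norm_of_nonneg (by positivity)]
      exact mul_le_mul_of_nonneg_left (hG l hkl l.lt_succ_self) (by positivity)
    calc ‖eulerSeq G x₀ ν (l + 1) - eulerSeq G x₀ ν k - ((l + 1 : ℕ) / ν - k / ν) • e‖
        = ‖(eulerSeq G x₀ ν l - eulerSeq G x₀ ν k - (l / ν - k / ν) • e)
            + (1 / ν) • (G (eulerSeq G x₀ ν l) - e)‖ := by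
          rw [eulerSeq]; congr 1; push_cast; module
      _ ≤ ε * (l / ν - k / ν) + 1 / ν * ε :=
          norm_add_le_of_le (ih fun i hki hil => hG i hki (hil.trans l.lt_succ_self)) hstep
      _ = ε * ((l + 1 : ℕ) / ν - k / ν) := by push_cast; ring

lemma norm_eulerSeq_sub_le (hM : ∀ y, ‖G y‖ ≤ M) (hν : 0 ≤ ν) (k l : ℕ) :
    ‖eulerSeq G x₀ ν l - eulerSeq G x₀ ν k‖ ≤ M * |l / ν - k / ν| := by
  wlog hkl : k ≤ l generalizing k l
  · rw [norm_sub_rev, abs_sub_comm]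
    exact this l k (le_of_not_ge hkl)
  have hbound := norm_eulerSeq_sub_sub_smul_le (x₀ := x₀) (e := 0) hν hkl fun i _ _ => by
    simpa using hM (eulerSeq G x₀ ν i)
  have hnonneg : 0 ≤ l / ν - k / ν := sub_nonneg.2 (by gcongr)
  simpa only [smul_zero, sub_zero, abs_of_nonneg hnonneg] using hbound

lemma exists_tendsto_eulerCurve [ProperSpace E] (hM : ∀ y, ‖G y‖ ≤ M) {𝒰 : Ultrafilter ℝ}
    (h𝒰 : (𝒰 : Filter ℝ) ≤ atTop) (x₀ : E) (t : ℝ) :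
    ∃ y, Tendsto (eulerCurve G x₀ · t) 𝒰 (𝓝 y) := by
  have hmem : ∀ᶠ ν : ℝ in atTop, eulerCurve G x₀ ν t ∈ Metric.closedBall x₀ (M * |t|) := by
    filter_upwards [eventually_gt_atTop 0] with ν hν
    have hfloor : |⌊t * ν⌋₊ / ν - (0 : ℕ) / ν| ≤ |t| := by
      rw [Nat.cast_zero, zero_div, sub_zero, abs_of_nonneg (by positivity), div_le_iff₀ hν]
      calc (⌊t * ν⌋₊ : ℝ) ≤ ⌊|t| * ν⌋₊ := by gcongr; exact le_abs_self t
        _ ≤ |t| * ν := Nat.floor_le (by positivity)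
    rw [mem_closedBall_iff_norm]
    exact (norm_eulerSeq_sub_le hM hν.le 0 _).trans
      (mul_le_mul_of_nonneg_left hfloor ((norm_nonneg _).trans (hM x₀)))
  obtain ⟨y, -, hy⟩ := (isCompact_closedBall x₀ (M * |t|)).ultrafilter_le_nhds
    (𝒰.map (eulerCurve G x₀ · t)) (le_principal_iff.2 (h𝒰 hmem))
  exact ⟨y, hy⟩

lemma eventually_norm_apply_eulerSeq_sub_le (h𝓕 : 𝓕 ≤ atTop) (hM : ∀ y, ‖G y‖ ≤ M)
    (hG : Continuous G) {t₀ : ℝ} (ht₀ : 0 ≤ t₀) (hε : 0 < ε) {y : E}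
    (hy : Tendsto (eulerCurve G x₀ · t₀) 𝓕 (𝓝 y)) :
    ∃ δ > 0, ∀ᶠ ν : ℝ in 𝓕, ∀ i : ℕ, |i / ν - t₀| < δ →
      ‖G (eulerSeq G x₀ ν i) - G y‖ ≤ ε := by
  have hM0 : 0 ≤ M := (norm_nonneg _).trans (hM 0)
  obtain ⟨ρ, hρ, hball⟩ := Metric.continuous_iff'.1 hG y ε hε |> Metric.eventually_nhds_iff.1
  have hδ : 0 < ρ / (4 * (M + 1)) := by positivity
  refine ⟨ρ / (4 * (M + 1)), hδ, ?_⟩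
  filter_upwards [h𝓕 (eventually_ge_atTop 0),
    Metric.tendsto_nhds.1 hy (ρ / 2) (half_pos hρ),
    Metric.tendsto_nhds.1 ((tendsto_nat_floor_mul_div_atTop ht₀).mono_left h𝓕) _ hδ]
    with ν hν hyν hfloor i hi
  rw [Real.dist_eq, abs_sub_comm] at hfloor
  have htime : |i / ν - ⌊t₀ * ν⌋₊ / ν| ≤ ρ / (4 * (M + 1)) + ρ / (4 * (M + 1)) :=
    (abs_sub_le _ t₀ _).trans (add_le_add hi.le hfloor.le)
  have hdist : dist (eulerSeq G x₀ ν i) (eulerCurve G x₀ ν t₀) ≤ ρ / 2 := by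
    rw [dist_eq_norm]
    refine (norm_eulerSeq_sub_le hM hν _ i).trans
      ((mul_le_mul_of_nonneg_left htime hM0).trans ?_)
    rw [← sub_nonneg]
    have : ρ / 2 - M * (ρ / (4 * (M + 1)) + ρ / (4 * (M + 1))) = ρ / (2 * (M + 1)) := by
      field_simp; ring
    rw [this]; positivity
  rw [← dist_eq_norm]
  exact (hball ((dist_triangle _ _ _).trans_lt (by linarith))).le

lemma exists_norm_sub_sub_smul_le_of_tendsto_eulerCurve [𝓕.NeBot] (h𝓕 : 𝓕 ≤ atTop)
    (hM : ∀ y, ‖G y‖ ≤ M) (hG : Continuous G)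
    (hx : ∀ t, Tendsto (eulerCurve G x₀ · t) 𝓕 (𝓝 (x t)))
    {t₀ : ℝ} (ht₀ : 0 ≤ t₀) (hε : 0 < ε) :
    ∃ δ > 0, ∀ s t, 0 ≤ s → s ≤ t → |s - t₀| < δ → |t - t₀| < δ →
      ‖x t - x s - (t - s) • G (x t₀)‖ ≤ ε * (t - s) := by
  obtain ⟨δ, hδ, hnear⟩ := eventually_norm_apply_eulerSeq_sub_le h𝓕 hM hG ht₀ hε (hx t₀)
  refine ⟨δ, hδ, fun s t hs hst hsδ htδ => ?_⟩
  have hfs := (tendsto_nat_floor_mul_div_atTop hs).mono_left h𝓕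
  have hft := (tendsto_nat_floor_mul_div_atTop (hs.trans hst)).mono_left h𝓕
  refine le_of_tendsto_of_tendsto (((hx t).sub (hx s)).sub ((hft.sub hfs).smul_const _)).norm
    ((hft.sub hfs).const_mul ε) ?_
  filter_upwards [hnear, h𝓕 (eventually_ge_atTop 0),
    (hfs.sub_const t₀).abs.eventually_lt_const hsδ,
    (hft.sub_const t₀).abs.eventually_lt_const htδ] with ν hnear hν hsν htν
  refine norm_eulerSeq_sub_sub_smul_le hν (by gcongr) fun i hsi hit => hnear i ?_
  rw [abs_lt] at hsν htν ⊢
  have hsi : (⌊s * ν⌋₊ : ℝ) / ν ≤ i / ν := by gcongr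
  have hit : (i : ℝ) / ν ≤ ⌊t * ν⌋₊ / ν := by gcongr
  constructor <;> linarith

/-- Peano's theorem. The solution is a pointwise limit, along an ultrafilter, of Euler schemes
with finer and finer steps. -/
theorem exists_hasDerivWithinAt_of_bounded [ProperSpace E] (hG : Continuous G)
    (hM : ∀ y, ‖G y‖ ≤ M) (x₀ : E) :
    ∃ x : ℝ → E, x 0 = x₀ ∧ ∀ t ≥ 0, HasDerivWithinAt x (G (x t)) (Ici 0) t := by
  choose x hx using exists_tendsto_eulerCurve hM (Ultrafilter.of_le atTop) x₀
  refine ⟨x, tendsto_nhds_unique (hx 0) (by simp [eulerCurve, eulerSeq]), fun t ht => ?_⟩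
  rw [hasDerivWithinAt_iff_isLittleO, Asymptotics.isLittleO_iff]
  intro ε hε
  obtain ⟨δ, hδ, hbound⟩ := exists_norm_sub_sub_smul_le_of_tendsto_eulerCurve
    (Ultrafilter.of_le atTop) hM hG hx ht hε
  filter_upwards [self_mem_nhdsWithin, mem_nhdsWithin_of_mem_nhds (Metric.ball_mem_nhds t hδ)]
    with s (hs : 0 ≤ s) hsδ
  rw [Metric.mem_ball, Real.dist_eq] at hsδ
  have htδ : |t - t| < δ := by simpa using hδ
  rcases le_total t s with hts | hst
  · simpa only [Real.norm_of_nonneg (sub_nonneg.2 hts)] using hbound t s ht hts htδ hsδ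
  · have hneg : x s - x t - (s - t) • G (x t) = -(x t - x s - (t - s) • G (x t)) := by module
    rw [hneg, norm_neg, norm_sub_rev s t, Real.norm_of_nonneg (sub_nonneg.2 hst)]
    exact hbound s t hs hst hsδ htδ

end Peano

section Continuation

variable {E : Type*} [NormedAddCommGroup E] [NormedSpace ℝ E] {G : E → E} {x q : ℝ → E} {T : ℝ}

lemma exists_bounded_eqOn_closedBall [ProperSpace E] (hG : Continuous G) (p : E) (R : ℝ) :
    ∃ (G' : E → E) (M : ℝ), Continuous G' ∧ (∀ y, ‖G' y‖ ≤ M) ∧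
      EqOn G' G (Metric.closedBall p R) := by
  obtain ⟨M, hM⟩ := (isCompact_closedBall p R).exists_bound_of_continuousOn hG.continuousOn
  have hpos : ∀ y, 0 < max (max M 1) ‖G y‖ := fun y => by positivity
  refine ⟨fun y => (max M 1 / max (max M 1) ‖G y‖) • G y, max M 1, ?_, fun y => ?_, fun y hy => ?_⟩
  · exact (Continuous.div continuous_const (by fun_prop) fun y => (hpos y).ne').smul hG
  · rw [norm_smul, Real.norm_of_nonneg (by positivity), div_mul_eq_mul_div, div_le_iff₀ (hpos y)]
    exact mul_le_mul_of_nonneg_left (le_max_right _ _) (by positivity)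
  · have hle : ‖G y‖ ≤ max M 1 := (hM y hy).trans (le_max_left _ _)
    simp only [max_eq_left hle, div_self (show max M 1 ≠ 0 by positivity), one_smul]

lemma forall_lt_of_forall_Ico_le {f : ℝ → ℝ} {b c : ℝ} (hf : ContinuousOn f (Ici 0))
    (hf0 : f 0 < c) (hbc : b < c)
    (hle : ∀ T > 0, (∀ t ∈ Ico 0 T, f t < c) → ∀ t ∈ Ico 0 T, f t ≤ b) :
    ∀ t ≥ 0, f t < c := by
  by_contra! hexit
  set S : Set ℝ := Ici 0 ∩ f ⁻¹' Ici c
  have hS : BddBelow S := ⟨0, fun t ht => ht.1⟩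
  obtain ⟨h0, hc⟩ : sInf S ∈ S :=
    (hf.preimage_isClosed_of_isClosed isClosed_Ici isClosed_Ici).csInf_mem hexit hS
  have hpos : 0 < sInf S := lt_of_le_of_ne h0 fun heq => hf0.not_ge (heq ▸ hc)
  have hbefore : ∀ t ∈ Ico 0 (sInf S), f t < c := fun t ht =>
    lt_of_not_ge fun hct => (csInf_le hS ⟨ht.1, hct⟩).not_gt ht.2
  have hlim : Tendsto f (𝓝[<] sInf S) (𝓝 (f (sInf S))) :=
    (hf _ h0).mono_left (nhdsWithin_le_of_mem (mem_nhdsWithin_of_mem_nhds (Ici_mem_nhds hpos)))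
  have hb : f (sInf S) ≤ b := le_of_tendsto hlim (by
    filter_upwards [Ico_mem_nhdsLT hpos] using hle _ hpos hbefore)
  exact (hb.trans_lt hbc).not_ge hc

lemma hasDerivWithinAt_Iic_of_tendsto (hG : Continuous G) (hT : 0 < T)
    (hx : ∀ t ∈ Ico 0 T, HasDerivWithinAt x (G (x t)) (Ico 0 T) t)
    (hlim : Tendsto x (𝓝[<] T) (𝓝 (x T))) : HasDerivWithinAt x (G (x T)) (Iic T) T := by
  have hderiv : ∀ t ∈ Ioo 0 T, HasDerivAt x (G (x t)) t := fun t ht =>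
    (hx t (Ioo_subset_Ico_self ht)).hasDerivAt (Ico_mem_nhds ht.1 ht.2)
  refine hasDerivWithinAt_Iic_of_tendsto_deriv (s := Ioo 0 T)
    (fun t ht => (hderiv t ht).differentiableAt.differentiableWithinAt)
    (hlim.mono_left (nhdsWithin_mono _ Ioo_subset_Iio_self)) (Ioo_mem_nhdsLT hT) ?_
  refine ((hG.tendsto _).comp hlim).congr' ?_
  filter_upwards [Ioo_mem_nhdsLT hT] with t ht using (hderiv t ht).deriv.symm

lemma hasDerivWithinAt_concat (hG : Continuous G) (hT : 0 < T)
    (hx : ∀ t ∈ Ico 0 T, HasDerivWithinAt x (G (x t)) (Ico 0 T) t)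
    (hq : ∀ t ≥ 0, HasDerivWithinAt q (G (q t)) (Ici 0) t)
    (hxq : Tendsto x (𝓝[<] T) (𝓝 (q 0))) {w : ℝ → E} (hwx : EqOn w x (Iio T))
    (hwq : ∀ t ≥ T, w t = q (t - T)) :
    ∀ t ≥ 0, HasDerivWithinAt w (G (w t)) (Ici 0) t := by
  have hleft : ∀ t ∈ Ico 0 T, HasDerivWithinAt w (G (w t)) (Ico 0 T) t := fun t ht => by
    rw [hwx ht.2]
    exact (hx t ht).congr (fun s hs => hwx hs.2) (hwx ht.2)
  have hright : ∀ t ≥ T, HasDerivWithinAt w (G (w t)) (Ici T) t := fun t ht => by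
    have hmaps : MapsTo (fun s => s - T) (Ici T) (Ici 0) := fun s hs =>
      mem_Ici.2 (sub_nonneg.2 hs)
    have hshift := (hq (t - T) (sub_nonneg.2 ht)).scomp t
      ((hasDerivWithinAt_id t (Ici T)).sub_const T) hmaps
    rw [hwq t ht]
    simpa only [one_smul] using hshift.congr (fun s hs => hwq s hs) (hwq t ht)
  intro t ht
  rcases lt_trichotomy t T with htT | rfl | htT
  · refine (hleft t ⟨ht, htT⟩).mono_of_mem_nhdsWithin ?_
    simpa only [Ici_inter_Iio] using inter_mem_nhdsWithin (Ici 0) (Iio_mem_nhds htT)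
  · have hlim : Tendsto w (𝓝[<] t) (𝓝 (w t)) := by
      rw [hwq t le_rfl, sub_self]
      exact hxq.congr' (hwx.symm.eventuallyEq_of_mem self_mem_nhdsWithin)
    have hunion := (hasDerivWithinAt_Iic_of_tendsto hG hT hleft hlim).union (hright t le_rfl)
    exact hunion.mono (by simp)
  · exact (hright t htT.le).mono_of_mem_nhdsWithin (mem_nhdsWithin_of_mem_nhds (Ici_mem_nhds htT))

lemma exists_tendsto_nhdsLT_of_norm_deriv_le [CompleteSpace E] {x' : ℝ → E} {M : ℝ}
    (hT : 0 < T) (hx : ∀ t ∈ Ico 0 T, HasDerivWithinAt x (x' t) (Ico 0 T) t)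
    (hM : ∀ t ∈ Ico 0 T, ‖x' t‖ ≤ M) : ∃ y, Tendsto x (𝓝[<] T) (𝓝 y) := by
  have hM' : ∀ t ∈ Ico 0 T, ‖x' t‖₊ ≤ M.toNNReal := fun t ht =>
    NNReal.le_toNNReal_of_coe_le (hM t ht)
  have hLip := (convex_Ico 0 T).lipschitzOnWith_of_nnnorm_hasDerivWithin_le hx hM'
  have hcauchy : Cauchy (map x (𝓝[<] T)) :=
    (cauchy_nhds.mono nhdsWithin_le_nhds).map_of_le hLip.uniformContinuousOn
      (le_principal_iff.2 (Ico_mem_nhdsLT hT))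
  exact cauchy_map_iff_exists_tendsto.1 hcauchy

end Continuation

section ForwardCompleteness

variable {n : ℕ}

lemma IsSolutionOn.mono {G : Vec n → Set (Vec n)} {x : ℝ → Vec n} {S S' : Set ℝ}
    (hx : IsSolutionOn G x S) (h : S' ⊆ S) : IsSolutionOn G x S' := fun t ht =>
  let ⟨ξ, hξ, hderiv⟩ := hx t (h ht)
  ⟨ξ, hξ, hderiv.mono h⟩

lemma isSolutionOn_singleton_iff {G : Vec n → Vec n} {x : ℝ → Vec n} {S : Set ℝ} :
    IsSolutionOn (fun y => {G y}) x S ↔ ∀ t ∈ S, HasDerivWithinAt x (G (x t)) S t := by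
  simp only [IsSolutionOn, mem_singleton_iff, exists_eq_left]

lemma SolutionsBounded.exists_isSolutionOn_Ici {G : Vec n → Vec n} {p : Vec n}
    (hb : SolutionsBounded (fun y => {G y}) p) (hG : Continuous G) (x₀ : Vec n) :
    ∃ x, IsSolutionOn (fun y => {G y}) x (Ici 0) ∧ x 0 = x₀ := by
  obtain ⟨R, hR⟩ := hb ‖x₀ - p‖
  obtain ⟨G', M, hG'c, hM, hG'⟩ := exists_bounded_eqOn_closedBall hG p (max R ‖x₀ - p‖ + 1)
  obtain ⟨x, rfl, hx⟩ := exists_hasDerivWithinAt_of_bounded hG'c hM x₀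
  have hstay : ∀ t ≥ 0, ‖x t - p‖ < max R ‖x 0 - p‖ + 1 := by
    refine forall_lt_of_forall_Ico_le
      (ContinuousOn.norm fun t ht => (hx t ht).continuousWithinAt.sub_const p)
      ((le_max_right R _).trans_lt (lt_add_one _)) ((le_max_left R _).trans_lt (lt_add_one _))
      fun T hT hlt => hR T hT x (isSolutionOn_singleton_iff.2 fun t ht => ?_) le_rfl
    rw [← hG' (mem_closedBall_iff_norm.2 (hlt t ht).le)]
    exact (hx t ht.1).mono Ico_subset_Ici_self
  refine ⟨x, isSolutionOn_singleton_iff.2 fun t ht => ?_, rfl⟩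
  rw [← hG' (mem_closedBall_iff_norm.2 (hstay t ht).le)]
  exact hx t ht

theorem SolutionsBounded.forwardComplete {G : Vec n → Vec n} {p : Vec n}
    (hb : SolutionsBounded (fun y => {G y}) p) (hG : Continuous G) :
    ForwardComplete fun y => {G y} := by
  refine ⟨hb.exists_isSolutionOn_Ici hG, fun T hT x hsol => ?_⟩
  have hx := isSolutionOn_singleton_iff.1 hsol
  obtain ⟨R, hR⟩ := hb ‖x 0 - p‖
  obtain ⟨M, hM⟩ := (isCompact_closedBall p R).exists_bound_of_continuousOn hG.continuousOn
  obtain ⟨y, hy⟩ := exists_tendsto_nhdsLT_of_norm_deriv_le hT hx fun t ht =>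
    hM _ (mem_closedBall_iff_norm.2 (hR T hT x hsol le_rfl t ht))
  obtain ⟨q, hq, rfl⟩ := hb.exists_isSolutionOn_Ici hG y
  refine ⟨fun t => if t < T then x t else q (t - T), isSolutionOn_singleton_iff.2 ?_,
    fun t ht => if_pos ht.2⟩
  exact hasDerivWithinAt_concat hG hT hx (isSolutionOn_singleton_iff.1 hq) hy
    (fun t ht => if_pos ht) fun t ht => if_neg (not_lt.2 ht)

end ForwardCompleteness

section LinearProgramming

lemma apply_sub_div_smul {R V : Type*} [Field R] [AddCommGroup V] [Module R V]
    (f a : Module.Dual R V) (x d : V) :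
    f (x - (a x / a d) • d) = (f - (f d / a d) • a) x := by
  simp only [map_sub, map_smul, smul_eq_mul, LinearMap.sub_apply, LinearMap.smul_apply]
  ring

variable {R V ι κ : Type*} [Field R] [LinearOrder R] [IsStrictOrderedRing R] [AddCommGroup V]
  [Module R V]

/-- Farkas' lemma. If the constraint `a i₀` matters, some `d` satisfies all the other constraints
with `b d < 0`, and translating along `d` eliminates `a i₀`. -/
theorem exists_nonneg_eq_sum_smul (s : Finset ι) (a : ι → Module.Dual R V) (b : Module.Dual R V)
    (hb : ∀ x, (∀ i ∈ s, 0 ≤ a i x) → 0 ≤ b x) :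
    ∃ u : ι → R, (∀ i, 0 ≤ u i) ∧ b = ∑ i ∈ s, u i • a i := by
  classical
  induction s using Finset.induction_on generalizing a b with
  | empty =>
    refine ⟨0, fun _ => le_rfl, LinearMap.ext fun x => le_antisymm ?_ (hb x (by simp))⟩
    simpa using hb (-x) (by simp)
  | insert i₀ s hi₀ ih =>
    suffices ∃ (c : R) (u : ι → R), 0 ≤ c ∧ (∀ i, 0 ≤ u i) ∧
        b = c • a i₀ + ∑ i ∈ s, u i • a i by
      obtain ⟨c, u, hc, hu, rfl⟩ := this
      refine ⟨Function.update u i₀ c, fun i => ?_, ?_⟩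
      · rcases eq_or_ne i i₀ with rfl | hi <;> simp [*]
      · rw [Finset.sum_insert hi₀, Function.update_self]
        refine congr_arg (c • a i₀ + ·) (Finset.sum_congr rfl fun i hi => ?_)
        rw [Function.update_of_ne (ne_of_mem_of_not_mem hi hi₀)]
    by_cases hred : ∀ x, (∀ i ∈ s, 0 ≤ a i x) → 0 ≤ b x
    · obtain ⟨u, hu, hbu⟩ := ih a b hred
      exact ⟨0, u, le_rfl, hu, by rw [hbu, zero_smul, zero_add]⟩
    push Not at hred
    obtain ⟨d, had, hbd⟩ := hred
    have hd₀ : a i₀ d < 0 := by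
      by_contra! h
      exact hbd.not_ge (hb d (Finset.forall_mem_insert .. |>.2 ⟨h, had⟩))
    obtain ⟨u, hu, hbu⟩ := ih (fun i => a i - (a i d / a i₀ d) • a i₀)
      (b - (b d / a i₀ d) • a i₀) fun x hx => by
        rw [← apply_sub_div_smul]
        refine hb _ (Finset.forall_mem_insert .. |>.2 ⟨?_, fun i hi => ?_⟩)
        · rw [apply_sub_div_smul, div_self hd₀.ne, one_smul, sub_self, LinearMap.zero_apply]
        · rw [apply_sub_div_smul]
          exact hx i hi
    refine ⟨b d / a i₀ d - ∑ i ∈ s, u i * (a i d / a i₀ d), u, ?_, hu, ?_⟩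
    · have hsum : ∑ i ∈ s, u i * (a i d / a i₀ d) ≤ 0 := Finset.sum_nonpos fun i hi =>
        mul_nonpos_of_nonneg_of_nonpos (hu i) (div_nonpos_of_nonneg_of_nonpos (had i hi) hd₀.le)
      linarith [div_pos_of_neg_of_neg hbd hd₀]
    · simp only [smul_sub, Finset.sum_sub_distrib, smul_smul, ← Finset.sum_smul] at hbu
      refine (eq_add_of_sub_eq hbu).trans ?_
      module

theorem exists_nonneg_eq_sum_smul_add_sum_smul [Fintype κ] (s : Finset ι)
    (a : ι → Module.Dual R V) (r : κ → Module.Dual R V) (b : Module.Dual R V)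
    (hb : ∀ x, (∀ i ∈ s, 0 ≤ a i x) → (∀ j, r j x = 0) → 0 ≤ b x) :
    ∃ (u : ι → R) (v : κ → R), (∀ i, 0 ≤ u i) ∧ b = ∑ i ∈ s, u i • a i + ∑ j, v j • r j := by
  have hker : ∀ x ∈ ⨅ j, LinearMap.ker (r j), ∀ j, r j x = 0 := by simp
  obtain ⟨u, hu, hbu⟩ := exists_nonneg_eq_sum_smul s
    (fun i => (a i).domRestrict (⨅ j, LinearMap.ker (r j))) (b.domRestrict _)
    fun x hx => hb x hx (hker x x.2)
  have hspan : b - ∑ i ∈ s, u i • a i ∈ Submodule.span R (range r) :=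
    mem_span_of_iInf_ker_le_ker fun x hx => by
      simpa [sub_eq_zero] using LinearMap.congr_fun hbu ⟨x, hx⟩
  obtain ⟨v, hv⟩ := (Submodule.mem_span_range_iff_exists_fun R).1 hspan
  exact ⟨u, v, hu, by rw [hv, add_sub_cancel]⟩

variable {E : Type*} [NormedAddCommGroup E] [InnerProductSpace ℝ E]

lemma inner_nonneg_of_isMinOn_polyhedron [Finite ι] {a : ι → E} {r : κ → E} {β : ι → ℝ}
    {q ξ x : E} (hξ : ∀ i, inner ℝ (a i) ξ ≤ β i)
    (hmin : ∀ ζ, (∀ i, inner ℝ (a i) ζ ≤ β i) → (∀ j, inner ℝ (r j) ζ = inner ℝ (r j) ξ) →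
      inner ℝ q ξ ≤ inner ℝ q ζ)
    (hax : ∀ i, inner ℝ (a i) ξ = β i → inner ℝ (a i) x ≤ 0) (hrx : ∀ j, inner ℝ (r j) x = 0) :
    0 ≤ inner ℝ q x := by
  have hstep : ∀ᶠ t : ℝ in 𝓝[>] 0, ∀ i, inner ℝ (a i) (ξ + t • x) ≤ β i := by
    refine eventually_all.2 fun i => ?_
    rcases (hξ i).eq_or_lt with hi | hi
    · filter_upwards [self_mem_nhdsWithin] with t (ht : 0 < t)
      rw [inner_add_right, real_inner_smul_right, hi]
      linarith [mul_nonpos_of_nonneg_of_nonpos ht.le (hax i hi)]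
    · have hcont : Continuous fun t : ℝ => inner ℝ (a i) (ξ + t • x) := by fun_prop
      exact nhdsWithin_le_nhds ((hcont.tendsto' 0 _ (by simp)).eventually_le_const hi)
  obtain ⟨t, ht, ht0 : 0 < t⟩ := (hstep.and self_mem_nhdsWithin).exists
  have hqt := hmin (ξ + t • x) ht fun j => by
    rw [inner_add_right, real_inner_smul_right, hrx j, mul_zero, add_zero]
  rw [inner_add_right, real_inner_smul_right, le_add_iff_nonneg_right] at hqt
  exact nonneg_of_mul_nonneg_right hqt ht0

theorem exists_multipliers_of_isMinOn_polyhedron [Fintype ι] [Fintype κ] {a : ι → E} {r : κ → E}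
    {β : ι → ℝ} {q ξ : E} (hξ : ∀ i, inner ℝ (a i) ξ ≤ β i)
    (hmin : ∀ ζ, (∀ i, inner ℝ (a i) ζ ≤ β i) → (∀ j, inner ℝ (r j) ζ = inner ℝ (r j) ξ) →
      inner ℝ q ξ ≤ inner ℝ q ζ) :
    ∃ (u : ι → ℝ) (v : κ → ℝ), (∀ i, 0 ≤ u i) ∧ (∀ i, u i * (inner ℝ (a i) ξ - β i) = 0) ∧
      q = -(∑ i, u i • a i + ∑ j, v j • r j) := by
  classical
  let s : Finset ι := {i | inner ℝ (a i) ξ = β i}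
  obtain ⟨u, v, hu, huv⟩ := exists_nonneg_eq_sum_smul_add_sum_smul s
    (fun i => -innerₗ E (a i)) (fun j => -innerₗ E (r j)) (innerₗ E q) fun x hax hrx =>
      inner_nonneg_of_isMinOn_polyhedron hξ hmin
        (fun i hi => neg_nonneg.1 (hax i (Finset.mem_filter_univ i |>.2 hi)))
        fun j => neg_eq_zero.1 (hrx j)
  refine ⟨fun i => if i ∈ s then u i else 0, v, fun i => ?_, fun i => ?_, ?_⟩
  · exact ite_nonneg (hu i) le_rfl
  · by_cases hi : i ∈ s
    · rw [Finset.mem_filter_univ i |>.1 hi, sub_self, mul_zero]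
    · simp only [if_neg hi, zero_mul]
  · refine ext_inner_right ℝ fun x => ?_
    simp only [ite_smul, zero_smul, Finset.sum_ite_mem, Finset.univ_inter]
    simpa [inner_add_left, inner_neg_left, sum_inner, real_inner_smul_left, add_comm] using
      LinearMap.congr_fun huv x

end LinearProgramming

section Gradient

variable {E : Type*} [NormedAddCommGroup E] [InnerProductSpace ℝ E] [CompleteSpace E]
  {f : E → ℝ} {x : ℝ → E} {ξ y : E} {S : Set ℝ} {t : ℝ}

lemma hasDerivWithinAt_comp_of_differentiableAt (hf : DifferentiableAt ℝ f (x t))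
    (hx : HasDerivWithinAt x ξ S t) :
    HasDerivWithinAt (fun s => f (x s)) (inner ℝ (gradient f (x t)) ξ) S t := by
  rw [inner_gradient_left]
  exact hf.hasFDerivAt.comp_hasDerivWithinAt t hx

lemma hasDerivAt_add_smul (hf : DifferentiableAt ℝ f y) (ξ : E) :
    HasDerivAt (fun s : ℝ => f (y + s • ξ)) (inner ℝ (gradient f y) ξ) 0 := by
  have hline : HasDerivAt (fun s : ℝ => y + s • ξ) ξ 0 := by
    simpa using ((hasDerivAt_id (0 : ℝ)).smul_const ξ).const_add y
  have hf0 : DifferentiableAt ℝ f (y + (0 : ℝ) • ξ) := by simpa using hf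
  simpa using (hasDerivWithinAt_comp_of_differentiableAt hf0 hline.hasDerivWithinAt).hasDerivAt
    univ_mem

lemma eventually_add_smul_neg (hf : DifferentiableAt ℝ f y) (hy : f y ≤ 0)
    (hξ : f y = 0 → inner ℝ (gradient f y) ξ < 0) :
    ∀ᶠ τ in 𝓝[>] (0 : ℝ), f (y + τ • ξ) < 0 := by
  have hderiv := hasDerivAt_add_smul hf ξ
  rcases hy.lt_or_eq with hlt | heq
  · exact nhdsWithin_le_nhds (hderiv.continuousAt.eventually_lt_const (by simpa using hlt))
  · have hDini := UpperRightDerivLE.of_hasDerivWithinAt (hderiv.hasDerivWithinAt (s := Ioi 0))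
    filter_upwards [hDini _ (half_pos (neg_pos.2 (hξ heq))), self_mem_nhdsWithin]
      with τ hτ (hτ0 : 0 < τ)
    rw [zero_smul, add_zero, heq, zero_add, sub_zero] at hτ
    refine hτ.trans_lt (mul_neg_of_neg_of_pos ?_ hτ0)
    linarith [hξ heq]

theorem inner_gradient_le_sub_of_convexOn (hf : DifferentiableAt ℝ f y)
    (hconv : ConvexOn ℝ univ f) (z : E) : inner ℝ (gradient f y) (z - y) ≤ f z - f y := by
  have hline : ConvexOn ℝ univ fun s : ℝ => f (y + s • (z - y)) :=
    (hconv.comp_affineMap (AffineMap.lineMap y z : ℝ →ᵃ[ℝ] E)).congr fun s _ => by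
      simp [AffineMap.lineMap_apply_module', add_comm]
  simpa [slope_def_field] using hline.le_slope_of_hasDerivAt (mem_univ 0) (mem_univ 1) zero_lt_one
    (hasDerivAt_add_smul hf (z - y))

theorem inner_sub_gradient_sub_nonneg_of_convexOn (hf : Differentiable ℝ f)
    (hconv : ConvexOn ℝ univ f) (y z : E) :
    0 ≤ inner ℝ (y - z) (gradient f y - gradient f z) := by
  have hyz := inner_gradient_le_sub_of_convexOn (hf y) hconv z
  have hzy := inner_gradient_le_sub_of_convexOn (hf z) hconv y
  rw [← neg_sub y z, inner_neg_right] at hyz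
  rw [real_inner_comm, inner_sub_left]
  linarith

end Gradient

section NearestPoint

variable {E : Type*} [NormedAddCommGroup E] [InnerProductSpace ℝ E]

/-- The metric projection of `p` onto `C`. It is meaningful when `C` is nonempty, closed and
convex; where there is no nearest point, the value is arbitrary. -/
def nearestPoint (C : Set E) (p : E) : E :=
  Classical.epsilon fun y => y ∈ C ∧ ∀ ζ ∈ C, ‖p - y‖ ≤ ‖p - ζ‖

variable {C : Set E} {p y ζ : E}

lemma nearestPoint_spec [CompleteSpace E] (hne : C.Nonempty) (hclosed : IsClosed C)
    (hconv : Convex ℝ C) (p : E) :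
    nearestPoint C p ∈ C ∧ ∀ ζ ∈ C, ‖p - nearestPoint C p‖ ≤ ‖p - ζ‖ := by
  obtain ⟨y, hy, hyp⟩ := exists_norm_eq_iInf_of_complete_convex hne hclosed.isComplete hconv p
  refine Classical.epsilon_spec (p := fun y => y ∈ C ∧ ∀ ζ ∈ C, ‖p - y‖ ≤ ‖p - ζ‖)
    ⟨y, hy, fun ζ hζ => hyp.trans_le ?_⟩
  exact ciInf_le ⟨0, forall_mem_range.2 fun _ => norm_nonneg _⟩ (⟨ζ, hζ⟩ : C)

lemma nearestPoint_mem [CompleteSpace E] (hne : C.Nonempty) (hclosed : IsClosed C)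
    (hconv : Convex ℝ C) (p : E) : nearestPoint C p ∈ C :=
  (nearestPoint_spec hne hclosed hconv p).1

lemma norm_sub_nearestPoint_le [CompleteSpace E] (hclosed : IsClosed C) (hconv : Convex ℝ C)
    (hζ : ζ ∈ C) (p : E) : ‖p - nearestPoint C p‖ ≤ ‖p - ζ‖ :=
  (nearestPoint_spec ⟨ζ, hζ⟩ hclosed hconv p).2 ζ hζ

theorem inner_sub_nearestPoint_nonpos [CompleteSpace E] (hclosed : IsClosed C)
    (hconv : Convex ℝ C) (hζ : ζ ∈ C) (p : E) :
    inner ℝ (p - nearestPoint C p) (ζ - nearestPoint C p) ≤ 0 := by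
  have hne : C.Nonempty := ⟨ζ, hζ⟩
  have : Nonempty C := hne.to_subtype
  refine (norm_eq_iInf_iff_real_inner_le_zero hconv (nearestPoint_mem hne hclosed hconv p)).1
    (le_antisymm (le_ciInf fun w => norm_sub_nearestPoint_le hclosed hconv w.2 p) ?_) ζ hζ
  exact ciInf_le ⟨0, forall_mem_range.2 fun _ => norm_nonneg _⟩
    (⟨_, nearestPoint_mem hne hclosed hconv p⟩ : C)

theorem eq_nearestPoint_of_norm_sub_le [CompleteSpace E] (hclosed : IsClosed C)
    (hconv : Convex ℝ C) (hy : y ∈ C) (hle : ‖p - y‖ ≤ ‖p - nearestPoint C p‖) :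
    y = nearestPoint C p := by
  have hinner := inner_sub_nearestPoint_nonpos hclosed hconv hy p
  have hsq : ‖p - y‖ ^ 2 ≤ ‖p - nearestPoint C p‖ ^ 2 := by gcongr
  rw [← sub_sub_sub_cancel_right p y (nearestPoint C p), norm_sub_sq_real] at hsq
  rw [← sub_eq_zero, ← norm_eq_zero, ← sq_eq_zero_iff]
  linarith [sq_nonneg ‖y - nearestPoint C p‖]

variable {X : Type*} [TopologicalSpace X] {K : X → Set E} {q : X → E} {x : X}

lemma eventually_norm_sub_nearestPoint_le [CompleteSpace E] (hclosed : ∀ x, IsClosed (K x))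
    (hconv : ∀ x, Convex ℝ (K x)) (hlower : LowerHemicontinuousAt K x) (hζ : ζ ∈ K x) {ε : ℝ}
    (hε : 0 < ε) : ∀ᶠ x' in 𝓝 x, ‖q x' - nearestPoint (K x') (q x')‖ ≤ ‖q x' - ζ‖ + ε := by
  filter_upwards [lowerHemicontinuousAt_iff.1 hlower _ Metric.isOpen_ball
    ⟨ζ, hζ, Metric.mem_ball_self hε⟩] with x' ⟨ζ', hζ', hζζ'⟩
  calc ‖q x' - nearestPoint (K x') (q x')‖ ≤ ‖q x' - ζ'‖ :=
        norm_sub_nearestPoint_le (hclosed x') (hconv x') hζ' _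
    _ ≤ ‖q x' - ζ‖ + ‖ζ - ζ'‖ := norm_sub_le_norm_sub_add_norm_sub ..
    _ ≤ ‖q x' - ζ‖ + ε := by gcongr; exact (mem_ball_iff_norm'.1 hζζ').le

theorem continuous_nearestPoint [ProperSpace E] (hne : ∀ x, (K x).Nonempty)
    (hconv : ∀ x, Convex ℝ (K x)) (hgraph : IsClosed {z : X × E | z.2 ∈ K z.1})
    (hlower : LowerHemicontinuous K) (hq : Continuous q) :
    Continuous fun x => nearestPoint (K x) (q x) := by
  have hclosed : ∀ x, IsClosed (K x) := fun x => hgraph.preimage (Continuous.prodMk_right x)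
  refine continuous_iff_continuousAt.2 fun x => ?_
  obtain ⟨ζ₀, hζ₀⟩ := hne x
  have hbound : ∀ᶠ x' in 𝓝 x,
      nearestPoint (K x') (q x') ∈ Metric.closedBall (q x) (‖q x - ζ₀‖ + 1 + 1 + 1) := by
    have hnear : Tendsto (fun x' => ‖q x' - ζ₀‖) (𝓝 x) (𝓝 ‖q x - ζ₀‖) :=
      (hq.sub continuous_const).norm.tendsto x
    filter_upwards [eventually_norm_sub_nearestPoint_le hclosed hconv (hlower x) hζ₀ one_pos,
      hnear.eventually_le_const (lt_add_one _),
      hq.continuousAt.eventually (Metric.ball_mem_nhds _ one_pos)] with x' hproj hζ hqx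
    rw [mem_closedBall_iff_norm']
    linarith [norm_sub_le_norm_sub_add_norm_sub (q x) (q x') (nearestPoint (K x') (q x')),
      mem_ball_iff_norm'.1 hqx]
  refine (isCompact_closedBall _ _).tendsto_nhds_of_unique_mapClusterPt hbound fun y _ hy => ?_
  obtain ⟨U, hUx, hUy⟩ := mapClusterPt_iff_ultrafilter.1 hy
  have hqU : Tendsto q U (𝓝 (q x)) := (hq.tendsto x).mono_left hUx
  have hyK : y ∈ K x := hgraph.mem_of_tendsto ((tendsto_id'.2 hUx).prodMk_nhds hUy)
    (Eventually.of_forall fun x' => nearestPoint_mem (hne x') (hclosed x') (hconv x') _)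
  refine eq_nearestPoint_of_norm_sub_le (hclosed x) (hconv x) hyK
    (le_of_forall_pos_le_add fun ε hε => ?_)
  exact le_of_tendsto_of_tendsto (hqU.sub hUy).norm ((hqU.sub_const _).norm.add_const ε)
    (hUx (eventually_norm_sub_nearestPoint_le hclosed hconv (hlower x)
      (nearestPoint_mem (hne x) (hclosed x) (hconv x) (q x)) hε))

end NearestPoint

section FeasibleVelocities

variable {n m k : ℕ}

/-- The standing hypotheses on the constraints `g ≤ 0`, `h = 0`: convex inequality constraints with
locally Lipschitz gradients, and affine equality constraints. -/
structure IsConvexSystem (g : Fin m → Vec n → ℝ) (h : Fin k → Vec n → ℝ) : Prop where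
  differentiable : ∀ i, Differentiable ℝ (g i)
  locallyLipschitz_gradient : ∀ i, LocallyLipschitz (gradient (g i))
  convexOn : ∀ i, ConvexOn ℝ univ (g i)
  sub_eq_inner : ∀ j x y, h j y - h j x = inner ℝ (gradient (h j) x) (y - x)

/-- Slater's constraint qualification, witnessed by `z`. -/
def IsSlaterPoint (g : Fin m → Vec n → ℝ) (h : Fin k → Vec n → ℝ) (z : Vec n) : Prop :=
  (∀ i, g i z < 0) ∧ ∀ j, h j z = 0

/-- The velocities at `x` that satisfy the control barrier conditions defining `Kcbf`. -/
def feasibleVelocities (g : Fin m → Vec n → ℝ) (h : Fin k → Vec n → ℝ) (α : ℝ) (x : Vec n) :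
    Set (Vec n) :=
  {ζ | (∀ i, inner ℝ (gradient (g i) x) ζ ≤ -α * g i x) ∧
    ∀ j, inner ℝ (gradient (h j) x) ζ = -α * h j x}

/-- The feasible velocities at which all the inequality conditions are strict. -/
def strictVelocities (g : Fin m → Vec n → ℝ) (h : Fin k → Vec n → ℝ) (α : ℝ) (x : Vec n) :
    Set (Vec n) :=
  {ζ | (∀ i, inner ℝ (gradient (g i) x) ζ < -α * g i x) ∧
    ∀ j, inner ℝ (gradient (h j) x) ζ = -α * h j x}

variable {g : Fin m → Vec n → ℝ} {h : Fin k → Vec n → ℝ} {α : ℝ} {x y z p : Vec n}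

lemma IsSlaterPoint.mem_constraintSet (hz : IsSlaterPoint g h z) : z ∈ constraintSet g h :=
  ⟨fun i => (hz.1 i).le, hz.2⟩

lemma convex_feasibleVelocities : Convex ℝ (feasibleVelocities g h α x) := by
  have hinter : feasibleVelocities g h α x =
      (⋂ i, {ζ | innerₗ (Vec n) (gradient (g i) x) ζ ≤ -α * g i x}) ∩
        ⋂ j, {ζ | innerₗ (Vec n) (gradient (h j) x) ζ = -α * h j x} := by
    ext
    simp [feasibleVelocities]
  rw [hinter]
  exact (convex_iInter fun i => convex_halfSpace_le (LinearMap.isLinear _) _).inter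
    (convex_iInter fun j => convex_hyperplane (LinearMap.isLinear _) _)

lemma isClosed_feasibleVelocities : IsClosed (feasibleVelocities g h α x) := by
  simp only [feasibleVelocities, ofPred_and, ofPred_forall]
  exact (isClosed_iInter fun i => isClosed_le (by fun_prop) continuous_const).inter
    (isClosed_iInter fun j => isClosed_eq (by fun_prop) continuous_const)

lemma feasibleVelocities_subset_closure_strictVelocities
    (hne : (strictVelocities g h α x).Nonempty) :
    feasibleVelocities g h α x ⊆ closure (strictVelocities g h α x) := by
  intro ζ hζ
  obtain ⟨w, hw⟩ := hne
  refine closure_mono ?_ (segment_subset_closure_openSegment (left_mem_segment ℝ ζ w))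
  rintro _ ⟨a, b, ha, hb, hab, rfl⟩
  refine ⟨fun i => ?_, fun j => ?_⟩ <;>
    simp only [inner_add_right, real_inner_smul_right]
  · linear_combination
      mul_le_mul_of_nonneg_left (hζ.1 i) ha.le + mul_lt_mul_of_pos_left (hw.1 i) hb -
        α * g i x * hab
  · linear_combination a * hζ.2 j + b * hw.2 j - α * h j x * hab

namespace IsConvexSystem

variable (P : IsConvexSystem g h)
include P

lemma gradient_eq (j : Fin k) (x y : Vec n) : gradient (h j) x = gradient (h j) y := by
  refine ext_inner_right ℝ fun w => ?_
  have hx := P.sub_eq_inner j x (x + w)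
  have hy := P.sub_eq_inner j y (x + w)
  have hyx := P.sub_eq_inner j y x
  rw [add_sub_cancel_left] at hx
  rw [add_sub_right_comm, inner_add_right] at hy
  linarith

lemma differentiable_affine (j : Fin k) : Differentiable ℝ (h j) := by
  have hj : h j = fun y => h j 0 + inner ℝ (gradient (h j) 0) y := funext fun y => by
    simpa [sub_eq_iff_eq_add'] using P.sub_eq_inner j 0 y
  rw [hj]
  exact (innerSL ℝ (gradient (h j) 0)).differentiable.const_add _

lemma smul_sub_mem_feasibleVelocities (hα : 0 ≤ α) (hy : y ∈ constraintSet g h) (x : Vec n) :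
    α • (y - x) ∈ feasibleVelocities g h α x := by
  refine ⟨fun i => ?_, fun j => ?_⟩ <;> rw [real_inner_smul_right]
  · have hgrad := inner_gradient_le_sub_of_convexOn (P.differentiable i x) (P.convexOn i) y
    linear_combination mul_le_mul_of_nonneg_left (hgrad.trans (sub_le_sub_right (hy.1 i) _)) hα
  · rw [← P.sub_eq_inner, hy.2 j, zero_sub, mul_neg, neg_mul]

lemma smul_sub_mem_strictVelocities (hα : 0 < α) (hz : IsSlaterPoint g h z) (x : Vec n) :
    α • (z - x) ∈ strictVelocities g h α x := by
  refine ⟨fun i => ?_,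
    (P.smul_sub_mem_feasibleVelocities hα.le hz.mem_constraintSet x).2⟩
  rw [real_inner_smul_right]
  have hgrad := inner_gradient_le_sub_of_convexOn (P.differentiable i x) (P.convexOn i) z
  linear_combination mul_lt_mul_of_pos_left (hgrad.trans_lt (sub_lt_sub_right (hz.1 i) _)) hα

lemma subset_closure_strictVelocities (hα : 0 < α) (hz : IsSlaterPoint g h z) (x : Vec n) :
    feasibleVelocities g h α x ⊆ closure (strictVelocities g h α x) :=
  feasibleVelocities_subset_closure_strictVelocities
    ⟨_, P.smul_sub_mem_strictVelocities hα hz x⟩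

lemma isClosed_graph_feasibleVelocities :
    IsClosed {z : Vec n × Vec n | z.2 ∈ feasibleVelocities g h α z.1} := by
  have hg := fun i => (P.differentiable i).continuous
  have hg' := fun i => (P.locallyLipschitz_gradient i).continuous
  have hh := fun j => (P.differentiable_affine j).continuous
  simp only [feasibleVelocities, mem_ofPred_eq, P.gradient_eq _ _ 0]
  simp only [ofPred_and, ofPred_forall]
  exact (isClosed_iInter fun i => isClosed_le (by fun_prop) (by fun_prop)).inter
    (isClosed_iInter fun j => isClosed_eq (by fun_prop) (by fun_prop))

/-- The correction `α (x - x')` carries the equality constraints from `x` to `x'`, and strict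
inequalities survive small perturbations. -/
theorem lowerHemicontinuous_feasibleVelocities (hα : 0 < α) (hz : IsSlaterPoint g h z) :
    LowerHemicontinuous (feasibleVelocities g h α) := by
  refine fun x => lowerHemicontinuousAt_iff.2 fun t ht ⟨ζ, hζ, hζt⟩ => ?_
  obtain ⟨w, hwt, hw⟩ :=
    mem_closure_iff.1 (P.subset_closure_strictVelocities hα hz x hζ) t ht hζt
  have hg := fun i => (P.differentiable i).continuous
  have hg' := fun i => (P.locallyLipschitz_gradient i).continuous
  let ω : Vec n → Vec n := fun x' => w + α • (x - x')
  have hω : Continuous ω := by fun_prop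
  have hωx : ω x = w := by simp [ω]
  have hineq : ∀ᶠ x' in 𝓝 x, ∀ i, inner ℝ (gradient (g i) x') (ω x') < -α * g i x' :=
    eventually_all.2 fun i => ((hg' i).inner hω).continuousAt.eventually_lt
      (continuous_const.mul (hg i)).continuousAt (by simpa only [hωx] using hw.1 i)
  filter_upwards [hineq, hω.continuousAt.eventually_mem (ht.mem_nhds (by rwa [hωx]))]
    with x' hx' hx't
  refine ⟨ω x', ⟨fun i => (hx' i).le, fun j => ?_⟩, hx't⟩
  rw [inner_add_right, real_inner_smul_right, ← P.sub_eq_inner, P.gradient_eq j x' x, hw.2 j]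
  ring

end IsConvexSystem

end FeasibleVelocities

section FlowField

variable {n m k : ℕ}

/-- The velocity of the safe monotone flow at `x`: the feasible velocity nearest to `-F x`. -/
def flowField (F : Vec n → Vec n) (g : Fin m → Vec n → ℝ) (h : Fin k → Vec n → ℝ) (α : ℝ)
    (x : Vec n) : Vec n :=
  nearestPoint (feasibleVelocities g h α x) (-F x)

variable {F : Vec n → Vec n} {g : Fin m → Vec n → ℝ} {h : Fin k → Vec n → ℝ} {α : ℝ}
  {x z p ζ : Vec n} {u : Fin m → ℝ} {v : Fin k → ℝ}

lemma flowField_mem (hne : (feasibleVelocities g h α x).Nonempty) :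
    flowField F g h α x ∈ feasibleVelocities g h α x :=
  nearestPoint_mem hne isClosed_feasibleVelocities convex_feasibleVelocities _

lemma inner_add_flowField_le (hζ : ζ ∈ feasibleVelocities g h α x) :
    inner ℝ (F x + flowField F g h α x) (flowField F g h α x) ≤
      inner ℝ (F x + flowField F g h α x) ζ := by
  have hproj := inner_sub_nearestPoint_nonpos isClosed_feasibleVelocities
    convex_feasibleVelocities hζ (-F x)
  rw [← neg_add', inner_neg_left, neg_nonpos, inner_sub_right, sub_nonneg] at hproj
  exact hproj

/-- The Karush–Kuhn–Tucker conditions for the projection defining `flowField`. -/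
theorem exists_multipliers_flowField (hne : (feasibleVelocities g h α x).Nonempty) :
    ∃ (u : Fin m → ℝ) (v : Fin k → ℝ), (∀ i, 0 ≤ u i) ∧
      (∀ i, u i * (inner ℝ (gradient (g i) x) (flowField F g h α x) - -α * g i x) = 0) ∧
      flowField F g h α x = controlField F g h x u v := by
  have hmem := flowField_mem (F := F) hne
  obtain ⟨u, v, hu, hcompl, hq⟩ := exists_multipliers_of_isMinOn_polyhedron
    (q := F x + flowField F g h α x) hmem.1 fun ζ hζ hrζ =>
      inner_add_flowField_le ⟨hζ, fun j => (hrζ j).trans (hmem.2 j)⟩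
  exact ⟨u, v, hu, hcompl, (eq_neg_add_of_add_eq hq).trans (sub_eq_add_neg ..).symm⟩

theorem safeMonotoneFlow_eq_singleton (hne : (feasibleVelocities g h α x).Nonempty) :
    safeMonotoneFlow F g h α x = {flowField F g h α x} := by
  have hcost : ∀ q : (Fin m → ℝ) × (Fin k → ℝ),
      inputCost g h x q = 1 / 2 * ‖-F x - controlField F g h x q.1 q.2‖ ^ 2 := fun q => by
    rw [inputCost, controlField, sub_sub_cancel]
  obtain ⟨u, v, hu, -, huv⟩ := exists_multipliers_flowField (F := F) hne
  have hmem : controlField F g h x u v ∈ feasibleVelocities g h α x := huv ▸ flowField_mem hne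
  have hK : (u, v) ∈ Kcbf F g h α x := ⟨hu, hmem⟩
  ext ξ
  refine ⟨?_, ?_⟩
  · rintro ⟨q, hq, hmin, rfl⟩
    refine eq_nearestPoint_of_norm_sub_le isClosed_feasibleVelocities convex_feasibleVelocities
      hq.2 (le_of_sq_le_sq ?_ (norm_nonneg _))
    have hle : inputCost g h x q ≤ inputCost g h x (u, v) := hmin hK
    rw [hcost, hcost, ← huv] at hle
    exact le_of_mul_le_mul_left hle one_half_pos
  · rintro rfl
    refine ⟨(u, v), hK, fun q hq => ?_, huv⟩
    change inputCost g h x (u, v) ≤ inputCost g h x q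
    rw [hcost, hcost, ← huv]
    gcongr
    exact norm_sub_nearestPoint_le isClosed_feasibleVelocities convex_feasibleVelocities hq.2 _

namespace IsConvexSystem

variable (P : IsConvexSystem g h)
include P

lemma nonempty_feasibleVelocities (hα : 0 ≤ α) (hne : (constraintSet g h).Nonempty)
    (x : Vec n) : (feasibleVelocities g h α x).Nonempty :=
  hne.elim fun _ hy => ⟨_, P.smul_sub_mem_feasibleVelocities hα hy x⟩

theorem continuous_flowField (hF : Continuous F) (hα : 0 < α) (hz : IsSlaterPoint g h z) :
    Continuous (flowField F g h α) :=
  continuous_nearestPoint (P.nonempty_feasibleVelocities hα.le ⟨z, hz.mem_constraintSet⟩)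
    (fun _ => convex_feasibleVelocities) P.isClosed_graph_feasibleVelocities
    (P.lowerHemicontinuous_feasibleVelocities hα hz) hF.neg

/-- For small `τ > 0` a strictly feasible velocity `ζ` gives
`g i (p + τ • ζ) ≤ (1 - α * τ) * g i p ≤ 0`. -/
lemma eventually_add_smul_mem_constraintSet (hp : p ∈ constraintSet g h)
    (hζ : ζ ∈ strictVelocities g h α p) : ∀ᶠ τ in 𝓝[>] (0 : ℝ), p + τ • ζ ∈ constraintSet g h := by
  have hα : ∀ᶠ τ in 𝓝[>] (0 : ℝ), α * τ ≤ 1 :=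
    nhdsWithin_le_nhds (((continuous_const_mul α).tendsto' 0 0 (mul_zero α)).eventually_le_const
      one_pos)
  have hg : ∀ i, ∀ᶠ τ in 𝓝[>] (0 : ℝ), g i (p + τ • ζ) ≤ g i p + -α * g i p * τ := fun i => by
    have hderiv := (hasDerivAt_add_smul (P.differentiable i p) ζ).hasDerivWithinAt (s := Ioi 0)
    simpa using UpperRightDerivLE.of_hasDerivWithinAt hderiv _ (sub_pos.2 (hζ.1 i))
  filter_upwards [hα, eventually_all.2 hg] with τ hτ hgτ
  refine ⟨fun i => (hgτ i).trans ?_, fun j => ?_⟩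
  · linear_combination mul_nonpos_of_nonneg_of_nonpos (sub_nonneg.2 hτ) (hp.1 i)
  · have haffine := P.sub_eq_inner j p (p + τ • ζ)
    rw [hp.2 j, sub_zero, add_sub_cancel_left, real_inner_smul_right, hζ.2 j, hp.2 j] at haffine
    rw [haffine, mul_zero, mul_zero]

lemma inner_nonneg_of_mem_SOL (hα : 0 < α) (hz : IsSlaterPoint g h z)
    (hp : p ∈ SOL F (constraintSet g h)) (hζ : ζ ∈ feasibleVelocities g h α p) :
    0 ≤ inner ℝ ζ (F p) := by
  refine closure_minimal (t := {ζ | 0 ≤ inner ℝ ζ (F p)}) (fun w hw => ?_)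
    (isClosed_le continuous_const (by fun_prop)) (P.subset_closure_strictVelocities hα hz p hζ)
  obtain ⟨τ, hτ, hτ0 : 0 < τ⟩ :=
    ((P.eventually_add_smul_mem_constraintSet hp.1 hw).and self_mem_nhdsWithin).exists
  have hVI := hp.2 _ hτ
  rw [add_sub_cancel_left, real_inner_smul_left] at hVI
  exact nonneg_of_mul_nonneg_right hVI hτ0

theorem flowField_eq_zero (hα : 0 < α) (hz : IsSlaterPoint g h z)
    (hp : p ∈ SOL F (constraintSet g h)) : flowField F g h α p = 0 := by
  have hzero : (0 : Vec n) ∈ feasibleVelocities g h α p := by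
    simpa using P.smul_sub_mem_feasibleVelocities hα.le hp.1 p
  refine norm_eq_zero.1 (sq_eq_zero_iff.1 (le_antisymm ?_ (sq_nonneg _)))
  have hFξ := P.inner_nonneg_of_mem_SOL hα hz hp (flowField_mem (F := F) ⟨0, hzero⟩)
  have hle := inner_add_flowField_le (F := F) hzero
  rw [inner_zero_right, inner_add_left, real_inner_comm, real_inner_self_eq_norm_sq] at hle
  linarith

theorem exists_multipliers_of_mem_SOL (hα : 0 < α) (hz : IsSlaterPoint g h z)
    (hp : p ∈ SOL F (constraintSet g h)) :
    ∃ (u : Fin m → ℝ) (v : Fin k → ℝ), (∀ i, 0 ≤ u i) ∧ (∀ i, u i * g i p = 0) ∧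
      F p = -inputTerm g h p u v := by
  obtain ⟨u, v, hu, hcompl, huv⟩ := exists_multipliers_flowField (F := F)
    (P.nonempty_feasibleVelocities hα.le ⟨p, hp.1⟩ p)
  rw [P.flowField_eq_zero hα hz hp] at hcompl huv
  refine ⟨u, v, hu, fun i => ?_, ?_⟩
  · simpa [hα.ne'] using hcompl i
  · rw [controlField, eq_comm, sub_eq_zero] at huv
    rw [← huv, neg_neg]

end IsConvexSystem

end FlowField

section Lyapunov

variable {n : ℕ}

/-- `V` is a Lyapunov function at `p` for `ẋ = G x`, with dissipation `μ ‖x - p‖ ^ 2`. No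
differentiability of `V` is required: the decay is expressed by Dini derivatives along curves. -/
structure IsLyapunovFunction (G : Vec n → Vec n) (p : Vec n) (μ : ℝ) (V : Vec n → ℝ) : Prop where
  continuous : Continuous V
  apply_self : V p = 0
  half_norm_sq_le : ∀ y, 1 / 2 * ‖y - p‖ ^ 2 ≤ V y
  upperRightDerivLE : ∀ (x : ℝ → Vec n) (t : ℝ), HasDerivWithinAt x (G (x t)) (Ioi t) t →
    UpperRightDerivLE (fun s => V (x s)) t (-(μ * ‖x t - p‖ ^ 2))

namespace IsLyapunovFunction

variable {G : Vec n → Vec n} {p : Vec n} {μ : ℝ} {V : Vec n → ℝ} (hV : IsLyapunovFunction G p μ V)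
  {x : ℝ → Vec n} {a b r T : ℝ}
include hV

lemma apply_le_sub_mul_sub (hμ : 0 ≤ μ) (hx : IsSolutionOn (fun y => {G y}) x (Ico 0 T))
    (ha : 0 ≤ a) (hab : a ≤ b) (hb : b < T) (hr : 0 ≤ r)
    (hrx : ∀ t ∈ Ico a b, r ≤ ‖x t - p‖) : V (x b) ≤ V (x a) - μ * r ^ 2 * (b - a) := by
  rw [isSolutionOn_singleton_iff] at hx
  have hcont : ContinuousOn (fun t => V (x t)) (Icc a b) := hV.continuous.comp_continuousOn
    fun t ht => ((hx t ⟨ha.trans ht.1, ht.2.trans_lt hb⟩).continuousWithinAt).mono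
      (Icc_subset_Ico_iff hab |>.2 ⟨ha, hb⟩)
  have hderiv : ∀ t ∈ Ico a b, UpperRightDerivLE (fun s => V (x s)) t (-(μ * r ^ 2)) :=
    fun t ht => by
      have htT : t ∈ Ico 0 T := ⟨ha.trans ht.1, ht.2.trans hb⟩
      refine (hV.upperRightDerivLE x t ((hx t htT).mono_of_mem_nhdsWithin ?_)).mono ?_
      · exact mem_of_superset (Ioo_mem_nhdsGT htT.2) fun s hs => ⟨htT.1.trans hs.1.le, hs.2⟩
      · gcongr
        exact hrx t ht
  linarith [UpperRightDerivLE.le_add_mul_sub hab hcont hderiv]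

lemma apply_le_apply (hμ : 0 ≤ μ) (hx : IsSolutionOn (fun y => {G y}) x (Ico 0 T))
    (ha : 0 ≤ a) (hab : a ≤ b) (hb : b < T) : V (x b) ≤ V (x a) := by
  simpa using hV.apply_le_sub_mul_sub hμ hx ha hab hb le_rfl fun t _ => norm_nonneg (x t - p)

lemma exists_forall_norm_sub_lt_imp_lt {ε : ℝ} (hε : 0 < ε) :
    ∃ δ > 0, ∀ y, ‖y - p‖ < δ → V y < ε := by
  have hlt : ∀ᶠ y in 𝓝 p, V y < ε :=
    hV.continuous.continuousAt.eventually_lt_const (by rwa [hV.apply_self])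
  simpa only [Metric.eventually_nhds_iff, dist_eq_norm] using hlt

lemma norm_sub_lt_of_apply_lt {y : Vec n} {ε : ℝ} (hε : 0 < ε) (hy : V y < 1 / 2 * ε ^ 2) :
    ‖y - p‖ < ε :=
  lt_of_pow_lt_pow_left₀ 2 hε.le (by linarith [hV.half_norm_sq_le y])

theorem lyapunovStable (hμ : 0 ≤ μ) : LyapunovStable (fun y => {G y}) p := by
  intro ε hε
  obtain ⟨δ, hδ, hVδ⟩ := hV.exists_forall_norm_sub_lt_imp_lt (half_pos (pow_pos hε 2))
  refine ⟨δ, hδ, fun T _ x hx hx0 t ht => hV.norm_sub_lt_of_apply_lt hε ?_⟩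
  linarith [hV.apply_le_apply hμ hx le_rfl ht.1 ht.2, hVδ _ hx0]

theorem solutionsBounded (hμ : 0 ≤ μ) : SolutionsBounded (fun y => {G y}) p := by
  intro r
  obtain ⟨M, hM⟩ :=
    (isCompact_closedBall p r).exists_bound_of_continuousOn hV.continuous.continuousOn
  refine ⟨√(2 * M), fun T _ x hx hx0 t ht => Real.le_sqrt_of_sq_le ?_⟩
  linarith [hV.half_norm_sq_le (x t), hV.apply_le_apply hμ hx le_rfl ht.1 ht.2,
    (Real.le_norm_self _).trans (hM _ (mem_closedBall_iff_norm.2 hx0))]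

lemma exists_norm_sub_lt (hμ : 0 < μ) (hx : IsSolutionOn (fun y => {G y}) x (Ici 0))
    (hr : 0 < r) : ∃ t ≥ 0, ‖x t - p‖ < r := by
  by_contra! hfar
  have hdecay : ∀ b ≥ 0, μ * r ^ 2 * b ≤ V (x 0) := fun b hb => by
    have hle := hV.apply_le_sub_mul_sub hμ.le (hx.mono Ico_subset_Ici_self) le_rfl hb
      (lt_add_one b) hr.le fun t ht => hfar t ht.1
    linarith [hV.half_norm_sq_le (x b), sq_nonneg ‖x b - p‖]
  obtain ⟨b, hb, hb0⟩ := (((tendsto_id.const_mul_atTop (by positivity : 0 < μ * r ^ 2)).eventually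
    (eventually_gt_atTop (V (x 0)))).and (eventually_ge_atTop 0)).exists
  exact (hdecay b hb0).not_gt hb

theorem tendsto_of_isSolutionOn (hμ : 0 < μ) (hx : IsSolutionOn (fun y => {G y}) x (Ici 0)) :
    Tendsto x atTop (𝓝 p) := by
  refine Metric.tendsto_atTop.2 fun ε hε => ?_
  obtain ⟨δ, hδ, hVδ⟩ := hV.exists_forall_norm_sub_lt_imp_lt (half_pos (pow_pos hε 2))
  obtain ⟨a, ha, hxa⟩ := hV.exists_norm_sub_lt hμ hx hδ
  refine ⟨a, fun t hat => dist_eq_norm (x t) p ▸ hV.norm_sub_lt_of_apply_lt hε ?_⟩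
  linarith [hV.apply_le_apply hμ.le (hx.mono Ico_subset_Ici_self) ha hat (lt_add_one t),
    hVδ _ hxa]

theorem globallyLyapunovStable (hμ : 0 ≤ μ) (hG : Continuous G) (hp : G p = 0) :
    GloballyLyapunovStable (fun y => {G y}) p :=
  ⟨hp.symm, (hV.solutionsBounded hμ).forwardComplete hG, hV.lyapunovStable hμ,
    hV.solutionsBounded hμ⟩

theorem globallyAsymptoticallyStable (hμ : 0 < μ) (hG : Continuous G) (hp : G p = 0) :
    GloballyAsymptoticallyStable (fun y => {G y}) p :=
  ⟨hV.globallyLyapunovStable hμ.le hG hp, fun _ => hV.tendsto_of_isSolutionOn hμ⟩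

end IsLyapunovFunction

end Lyapunov

section LyapunovFunction

variable {n m k : ℕ}

/-- The value `uᵀ g(x) + vᵀ h(x)` of the Lagrangian penalty with multipliers `(u, v)`. -/
def constraintSum (g : Fin m → Vec n → ℝ) (h : Fin k → Vec n → ℝ) (u : Fin m → ℝ)
    (v : Fin k → ℝ) (x : Vec n) : ℝ :=
  ∑ i, u i * g i x + ∑ j, v j * h j x

/-- The minimum `W(x)` of `F(x)ᵀ ζ + ½ ‖ζ‖²` over the feasible velocities `ζ` at `x`. -/
def flowValue (F : Vec n → Vec n) (g : Fin m → Vec n → ℝ) (h : Fin k → Vec n → ℝ) (α : ℝ)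
    (x : Vec n) : ℝ :=
  inner ℝ (F x) (flowField F g h α x) + 1 / 2 * ‖flowField F g h α x‖ ^ 2

/-- The squared distance to `p`, corrected by the negative part of `flowValue` and the positive part
of `constraintSum`. With `(u, v)` multipliers of the variational inequality at `p`, it decreases
along the safe monotone flow. -/
def lyapunovFunction (F : Vec n → Vec n) (g : Fin m → Vec n → ℝ) (h : Fin k → Vec n → ℝ) (α : ℝ)
    (p : Vec n) (u : Fin m → ℝ) (v : Fin k → ℝ) (x : Vec n) : ℝ :=
  1 / 2 * ‖x - p‖ ^ 2 + max (-flowValue F g h α x / α ^ 2) 0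
    + max (constraintSum g h u v x) 0 / α

variable {F : Vec n → Vec n} {g : Fin m → Vec n → ℝ} {h : Fin k → Vec n → ℝ} {α μ : ℝ}
  {z p y ξ ζ : Vec n} {u : Fin m → ℝ} {x : ℝ → Vec n} {S : Set ℝ} {t : ℝ}

lemma inner_inputTerm (g : Fin m → Vec n → ℝ) (h : Fin k → Vec n → ℝ) (y : Vec n)
    (u : Fin m → ℝ) (v : Fin k → ℝ) (ζ : Vec n) :
    inner ℝ (inputTerm g h y u v) ζ =
      ∑ i, u i * inner ℝ (gradient (g i) y) ζ + ∑ j, v j * inner ℝ (gradient (h j) y) ζ := by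
  simp only [inputTerm, inner_add_left, sum_inner, real_inner_smul_left]

lemma inner_inputTerm_le (hu : ∀ i, 0 ≤ u i) (v : Fin k → ℝ)
    (hζ : ζ ∈ feasibleVelocities g h α y) :
    inner ℝ (inputTerm g h y u v) ζ ≤ -α * constraintSum g h u v y := by
  rw [inner_inputTerm, constraintSum, mul_add, Finset.mul_sum, Finset.mul_sum]
  refine add_le_add (Finset.sum_le_sum fun i _ => ?_) (Finset.sum_le_sum fun j _ => ?_)
  · rw [mul_left_comm]
    exact mul_le_mul_of_nonneg_left (hζ.1 i) (hu i)
  · rw [hζ.2 j, mul_left_comm]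

/-- Weak duality for the minimization defining `flowValue`. -/
lemma dual_le_flowValue (hne : (feasibleVelocities g h α y).Nonempty) (hu : ∀ i, 0 ≤ u i)
    (v : Fin k → ℝ) :
    -(1 / 2 * ‖F y + inputTerm g h y u v‖ ^ 2) + α * constraintSum g h u v y
      ≤ flowValue F g h α y := by
  have hinner := inner_inputTerm_le hu v (flowField_mem (F := F) hne)
  have hsq := sq_nonneg ‖(F y + inputTerm g h y u v) + flowField F g h α y‖
  rw [norm_add_sq_real (F y + inputTerm g h y u v), inner_add_left] at hsq
  rw [flowValue]
  linarith

/-- Strong duality: the multipliers attain equality in `dual_le_flowValue`. -/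
lemma exists_multipliers_flowValue (F : Vec n → Vec n)
    (hne : (feasibleVelocities g h α y).Nonempty) :
    ∃ (u : Fin m → ℝ) (v : Fin k → ℝ), (∀ i, 0 ≤ u i) ∧
      F y + inputTerm g h y u v = -flowField F g h α y ∧
      α * constraintSum g h u v y = flowValue F g h α y + 1 / 2 * ‖flowField F g h α y‖ ^ 2 := by
  obtain ⟨u, v, hu, hcompl, huv⟩ := exists_multipliers_flowField (F := F) hne
  have hN : F y + inputTerm g h y u v = -flowField F g h α y := by
    rw [huv, controlField, neg_sub, sub_neg_eq_add, add_comm]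
  refine ⟨u, v, hu, hN, ?_⟩
  have hinner : inner ℝ (inputTerm g h y u v) (flowField F g h α y)
      = -α * constraintSum g h u v y := by
    rw [inner_inputTerm, constraintSum, mul_add, Finset.mul_sum, Finset.mul_sum]
    congr 1 <;> refine Finset.sum_congr rfl fun i _ => ?_
    · linear_combination hcompl i
    · rw [(flowField_mem hne).2 i, mul_left_comm]
  rw [eq_neg_add_of_add_eq hN, inner_add_left, inner_neg_left, inner_neg_left,
    real_inner_self_eq_norm_sq] at hinner
  rw [flowValue]
  linarith

lemma locallyLipschitz_const_smul {E : Type*} [NormedAddCommGroup E] [NormedSpace ℝ E]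
    {f : E → E} (hf : LocallyLipschitz f) (a : ℝ) : LocallyLipschitz fun y => a • f y :=
  (lipschitzWith_smul a).locallyLipschitz.comp hf

lemma locallyLipschitz_sum {ι X E : Type*} [PseudoEMetricSpace X] [SeminormedAddCommGroup E]
    {s : Finset ι} {f : ι → X → E} (hf : ∀ i ∈ s, LocallyLipschitz (f i)) :
    LocallyLipschitz fun y => ∑ i ∈ s, f i y := by
  simpa only [Finset.sum_fn] using
    Finset.sum_induction f LocallyLipschitz (fun _ _ => LocallyLipschitz.add) (.const 0) hf

namespace IsConvexSystem

variable (P : IsConvexSystem g h)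
include P

lemma continuous_constraintSum (u : Fin m → ℝ) (v : Fin k → ℝ) :
    Continuous (constraintSum g h u v) := by
  have hg := fun i => (P.differentiable i).continuous
  have hh := fun j => (P.differentiable_affine j).continuous
  unfold constraintSum
  fun_prop

lemma hasDerivWithinAt_constraintSum (u : Fin m → ℝ) (v : Fin k → ℝ)
    (hx : HasDerivWithinAt x ξ S t) :
    HasDerivWithinAt (fun s => constraintSum g h u v (x s))
      (inner ℝ (inputTerm g h (x t) u v) ξ) S t := by
  rw [inner_inputTerm]
  exact (HasDerivWithinAt.fun_sum fun i _ =>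
      (hasDerivWithinAt_comp_of_differentiableAt (P.differentiable i _) hx).const_mul (u i)).add
    (HasDerivWithinAt.fun_sum fun j _ =>
      (hasDerivWithinAt_comp_of_differentiableAt (P.differentiable_affine j _) hx).const_mul (v j))

lemma inner_sub_add_inputTerm_nonneg (hF : IsMonotoneMap F) (hu : ∀ i, 0 ≤ u i) (v : Fin k → ℝ)
    (y z : Vec n) :
    0 ≤ inner ℝ (y - z) ((F y + inputTerm g h y u v) - (F z + inputTerm g h z u v)) := by
  have hsub : (F y + inputTerm g h y u v) - (F z + inputTerm g h z u v)
      = (F y - F z) + ∑ i, u i • (gradient (g i) y - gradient (g i) z) := by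
    simp only [inputTerm, P.gradient_eq _ y z, smul_sub, Finset.sum_sub_distrib]
    abel
  rw [hsub, inner_add_right, inner_sum]
  refine add_nonneg (hF y z) (Finset.sum_nonneg fun i _ => ?_)
  rw [real_inner_smul_right]
  exact mul_nonneg (hu i)
    (inner_sub_gradient_sub_nonneg_of_convexOn (P.differentiable i) (P.convexOn i) y z)

lemma locallyLipschitz_add_inputTerm (hF : LocallyLipschitz F) (u : Fin m → ℝ)
    (v : Fin k → ℝ) : LocallyLipschitz fun y => F y + inputTerm g h y u v := by
  simp only [inputTerm, P.gradient_eq _ _ 0]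
  exact hF.add ((locallyLipschitz_sum fun i _ =>
    locallyLipschitz_const_smul (P.locallyLipschitz_gradient i) (u i)).add (.const _))

lemma continuous_flowValue (hF : Continuous F) (hα : 0 < α) (hz : IsSlaterPoint g h z) :
    Continuous (flowValue F g h α) := by
  have hG := P.continuous_flowField hF hα hz
  unfold flowValue
  fun_prop

/-- The dual objective with the multipliers of `x t` fixed bounds `-flowValue` from above, with
equality at time `t`. -/
theorem upperRightDerivLE_neg_flowValue (hF : IsMonotoneMap F) (hLip : LocallyLipschitz F)
    (hne : ∀ y, (feasibleVelocities g h α y).Nonempty)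
    (hx : HasDerivWithinAt x (flowField F g h α (x t)) (Ioi t) t) :
    UpperRightDerivLE (fun s => -flowValue F g h α (x s)) t
      (α * (flowValue F g h α (x t) + 1 / 2 * ‖flowField F g h α (x t)‖ ^ 2)) := by
  obtain ⟨u, v, hu, hN, hL⟩ := exists_multipliers_flowValue F (hne (x t))
  have hsq : UpperRightDerivLE (fun s => ‖F (x s) + inputTerm g h (x s) u v‖ ^ 2) t 0 :=
    UpperRightDerivLE.norm_sq_of_monotone (N := fun y => F y + inputTerm g h y u v)
      (P.inner_sub_add_inputTerm_nonneg hF hu v) (P.locallyLipschitz_add_inputTerm hLip u v)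
      (by rwa [hN, neg_neg])
  have hsum := UpperRightDerivLE.of_hasDerivWithinAt
    ((P.hasDerivWithinAt_constraintSum u v hx).const_mul (-α))
  refine (((hsq.const_mul one_half_pos).add hsum).mono (le_of_eq ?_)).of_le_of_eq
    (fun s => by linarith [dual_le_flowValue (F := F) (hne (x s)) hu v]) ?_
  · rw [eq_neg_add_of_add_eq hN, inner_add_left, inner_neg_left, inner_neg_left,
      real_inner_self_eq_norm_sq, flowValue]
    ring
  · rw [hN, norm_neg]
    linarith

lemma inner_sub_flowField_le (hα : 0 < α) (hp : p ∈ constraintSet g h) (y : Vec n) :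
    inner ℝ (y - p) (flowField F g h α y) ≤ -inner ℝ (y - p) (F y) -
      (flowValue F g h α y + 1 / 2 * ‖flowField F g h α y‖ ^ 2) / α := by
  have hle := inner_add_flowField_le (F := F) (P.smul_sub_mem_feasibleVelocities hα.le hp y)
  rw [← neg_sub y p, smul_neg, inner_neg_right, real_inner_smul_right, real_inner_comm (y - p),
    inner_add_right, inner_add_left, real_inner_self_eq_norm_sq] at hle
  rw [le_sub_iff_add_le, ← le_sub_iff_add_le', div_le_iff₀ hα, flowValue]
  linarith

lemma neg_inner_le_constraintSum {v : Fin k → ℝ} (hp : p ∈ constraintSet g h)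
    (hu : ∀ i, 0 ≤ u i) (hcompl : ∀ i, u i * g i p = 0) (hFp : F p = -inputTerm g h p u v)
    (y : Vec n) : -inner ℝ (y - p) (F p) ≤ constraintSum g h u v y := by
  rw [hFp, inner_neg_right, neg_neg, real_inner_comm, inner_inputTerm, constraintSum]
  refine add_le_add (Finset.sum_le_sum fun i _ => ?_) (Finset.sum_le_sum fun j _ => ?_)
  · have hgrad := inner_gradient_le_sub_of_convexOn (P.differentiable i p) (P.convexOn i) y
    linarith [mul_le_mul_of_nonneg_left hgrad (hu i), hcompl i]
  · rw [← P.sub_eq_inner, hp.2 j, sub_zero]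

lemma upperRightDerivLE_max_constraintSum (hu : ∀ i, 0 ≤ u i) (v : Fin k → ℝ)
    (hne : (feasibleVelocities g h α (x t)).Nonempty)
    (hx : HasDerivWithinAt x (flowField F g h α (x t)) (Ioi t) t) :
    UpperRightDerivLE (fun s => max (constraintSum g h u v (x s)) 0) t
      (-α * max (constraintSum g h u v (x t)) 0) := by
  have hderiv := P.hasDerivWithinAt_constraintSum u v hx
  refine UpperRightDerivLE.max hderiv.continuousWithinAt continuousWithinAt_const
    (fun hnonneg => ?_) (fun hnonpos => ?_)
  · rw [max_eq_left hnonneg]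
    exact (UpperRightDerivLE.of_hasDerivWithinAt hderiv).mono
      (inner_inputTerm_le hu v (flowField_mem hne))
  · rw [max_eq_right hnonpos, mul_zero]
    exact UpperRightDerivLE.of_hasDerivWithinAt (hasDerivWithinAt_const t _ 0)

/-- Where `flowValue` is negative, the growth of its negative part is exactly compensated by the
decay of the squared distance. -/
lemma upperRightDerivLE_norm_sq_add_max (hF : IsMonotoneMap F) (hLip : LocallyLipschitz F)
    (hα : 0 < α) (hz : IsSlaterPoint g h z) (hp : p ∈ constraintSet g h)
    (hx : HasDerivWithinAt x (flowField F g h α (x t)) (Ioi t) t) :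
    UpperRightDerivLE
      (fun s => 1 / 2 * ‖x s - p‖ ^ 2 + max (-flowValue F g h α (x s) / α ^ 2) 0) t
      (-inner ℝ (x t - p) (F (x t))) := by
  have hne := P.nonempty_feasibleVelocities hα.le ⟨p, hp⟩
  have hdist : HasDerivWithinAt (fun s => 1 / 2 * ‖x s - p‖ ^ 2)
      (inner ℝ (x t - p) (flowField F g h α (x t))) (Ioi t) t :=
    ((hx.sub_const p).norm_sq.const_mul (1 / 2)).congr_deriv (by ring)
  have hvalue : UpperRightDerivLE (fun s => -flowValue F g h α (x s) / α ^ 2) t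
      ((flowValue F g h α (x t) + 1 / 2 * ‖flowField F g h α (x t)‖ ^ 2) / α) := by
    simp only [div_eq_inv_mul (-flowValue F g h α _)]
    refine ((P.upperRightDerivLE_neg_flowValue hF hLip hne hx).const_mul
      (inv_pos.2 (pow_pos hα 2))).mono (le_of_eq ?_)
    field_simp
  have hcont : ContinuousWithinAt (fun s => -flowValue F g h α (x s) / α ^ 2) (Ioi t) t :=
    ((P.continuous_flowValue hLip.continuous hα hz).neg.div_const _).continuousAt
      |>.comp_continuousWithinAt hx.continuousWithinAt
  have hinner := P.inner_sub_flowField_le (F := F) hα hp (x t)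
  simp only [← max_add_add_left, add_zero]
  refine UpperRightDerivLE.max (hdist.continuousWithinAt.add hcont) hdist.continuousWithinAt
    (fun _ => ?_) (fun hW => ?_)
  · exact ((UpperRightDerivLE.of_hasDerivWithinAt hdist).add hvalue).mono (by linarith)
  · refine (UpperRightDerivLE.of_hasDerivWithinAt hdist).mono ?_
    have hWnonneg : 0 ≤ flowValue F g h α (x t) := by
      rwa [add_le_iff_nonpos_right, neg_div, neg_nonpos, le_div_iff₀ (pow_pos hα 2), zero_mul] at hW
    have : 0 ≤ (flowValue F g h α (x t) + 1 / 2 * ‖flowField F g h α (x t)‖ ^ 2) / α := by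
      positivity
    linarith

lemma lyapunovFunction_self {v : Fin k → ℝ} (hα : 0 < α) (hz : IsSlaterPoint g h z)
    (hp : p ∈ SOL F (constraintSet g h)) (hcompl : ∀ i, u i * g i p = 0) :
    lyapunovFunction F g h α p u v p = 0 := by
  simp [lyapunovFunction, flowValue, constraintSum, P.flowField_eq_zero hα hz hp, hcompl, hp.1.2]

theorem exists_isLyapunovFunction (hμ : 0 ≤ μ) (hF : IsStronglyMonotoneMap μ F)
    (hLip : LocallyLipschitz F) (hα : 0 < α) (hz : IsSlaterPoint g h z)
    (hp : p ∈ SOL F (constraintSet g h)) :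
    ∃ V, IsLyapunovFunction (flowField F g h α) p μ V := by
  obtain ⟨u, v, hu, hcompl, hFp⟩ := P.exists_multipliers_of_mem_SOL hα hz hp
  have hmono : IsMonotoneMap F := fun y₁ y₂ => (by positivity : (0 : ℝ) ≤ _).trans (hF y₁ y₂)
  refine ⟨lyapunovFunction F g h α p u v, ?_, P.lyapunovFunction_self hα hz hp hcompl,
    fun y => ?_, fun x t hx => ?_⟩
  · have hW := P.continuous_flowValue hLip.continuous hα hz
    have hL := P.continuous_constraintSum u v
    unfold lyapunovFunction
    fun_prop
  · rw [lyapunovFunction, add_assoc]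
    exact le_add_of_nonneg_right (by positivity)
  · simp only [lyapunovFunction, div_eq_inv_mul (max _ _)]
    refine ((P.upperRightDerivLE_norm_sq_add_max hmono hLip hα hz hp.1 hx).add
      ((P.upperRightDerivLE_max_constraintSum hu v
        (P.nonempty_feasibleVelocities hα.le ⟨p, hp.1⟩ _) hx).const_mul (inv_pos.2 hα))).mono ?_
    have hFx := hF (x t) p
    rw [inner_sub_right] at hFx
    rw [neg_mul, mul_neg, inv_mul_cancel_left₀ hα.ne']
    linarith [P.neg_inner_le_constraintSum hp.1 hu hcompl hFp (x t),
      le_max_left (constraintSum g h u v (x t)) 0]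

end IsConvexSystem

end LyapunovFunction

section AffineConstraint

variable {n m k : ℕ}

lemma affineConstraint_eq_inner_sub (H : Matrix (Fin k) (Fin n) ℝ) (c : Fin k → ℝ) (j : Fin k)
    (x : Vec n) : affineConstraint H c j x = inner ℝ (WithLp.toLp 2 (H j)) x - c j := by
  simp [affineConstraint, PiLp.inner_apply, mul_comm]

lemma gradient_affineConstraint (H : Matrix (Fin k) (Fin n) ℝ) (c : Fin k → ℝ) (j : Fin k)
    (x : Vec n) : gradient (affineConstraint H c j) x = WithLp.toLp 2 (H j) := by
  rw [funext (affineConstraint_eq_inner_sub H c j)]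
  exact HasGradientAt.gradient ((innerSL ℝ (WithLp.toLp 2 (H j))).hasFDerivAt.sub_const _)

lemma affineConstraint_sub (H : Matrix (Fin k) (Fin n) ℝ) (c : Fin k → ℝ) (j : Fin k)
    (x y : Vec n) : affineConstraint H c j y - affineConstraint H c j x =
      inner ℝ (gradient (affineConstraint H c j) x) (y - x) := by
  rw [gradient_affineConstraint, affineConstraint_eq_inner_sub, affineConstraint_eq_inner_sub,
    inner_sub_right, sub_sub_sub_cancel_right]

theorem isConvexSystem_affineConstraint {g : Fin m → Vec n → ℝ} (hg : ∀ i, Differentiable ℝ (g i))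
    (hg' : ∀ i, LocallyLipschitz (gradient (g i))) (hconv : ∀ i, ConvexOn ℝ univ (g i))
    (H : Matrix (Fin k) (Fin n) ℝ) (c : Fin k → ℝ) : IsConvexSystem g (affineConstraint H c) :=
  ⟨hg, hg', hconv, affineConstraint_sub H c⟩

variable {g : Fin m → Vec n → ℝ} {h : Fin k → Vec n → ℝ} {x : Vec n}

namespace IsConvexSystem

variable (P : IsConvexSystem g h)
include P

lemma exists_isSlaterPoint_of_MFCQ (hx : x ∈ constraintSet g h) (hM : MFCQ g h x) :
    ∃ z, IsSlaterPoint g h z := by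
  obtain ⟨-, ξ, hξg, hξh⟩ := hM
  obtain ⟨τ, hτ⟩ := (eventually_all.2 fun i =>
    eventually_add_smul_neg (P.differentiable i x) (hx.1 i) (hξg i)).exists
  refine ⟨x + τ • ξ, hτ, fun j => ?_⟩
  have haffine := P.sub_eq_inner j x (x + τ • ξ)
  rwa [add_sub_cancel_left, real_inner_smul_right, hξh j, mul_zero, hx.2 j, sub_zero] at haffine

end IsConvexSystem

end AffineConstraint

end SafeMonotone

end

open SafeMonotone in
theorem mainTheorem2_general {n m k : ℕ} {F : Vec n → Vec n} {g : Fin m → Vec n → ℝ}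
    {h : Fin k → Vec n → ℝ} {α : ℝ} (hα : 0 < α) (hF : LocallyLipschitz F)
    (P : IsConvexSystem g h)
    (hSlater : (constraintSet g h).Nonempty → ∃ z, IsSlaterPoint g h z) :
    (IsMonotoneMap F → ∀ p ∈ SOL F (constraintSet g h),
      GloballyLyapunovStable (safeMonotoneFlow F g h α) p) ∧
    (∀ μ : ℝ, 0 < μ → IsStronglyMonotoneMap μ F → ∀ p ∈ SOL F (constraintSet g h),
      GloballyAsymptoticallyStable (safeMonotoneFlow F g h α) p) := by
  have hflow : (constraintSet g h).Nonempty →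
      safeMonotoneFlow F g h α = fun x => {flowField F g h α x} := fun hne => funext fun x =>
    safeMonotoneFlow_eq_singleton (P.nonempty_feasibleVelocities hα.le hne x)
  refine ⟨fun hmono p hp => ?_, fun μ hμ hstrong p hp => ?_⟩ <;>
    obtain ⟨z, hz⟩ := hSlater ⟨p, hp.1⟩ <;>
    rw [hflow ⟨p, hp.1⟩]
  · have hmono₀ : IsStronglyMonotoneMap 0 F := fun x₁ x₂ => by
      simpa only [zero_mul] using hmono x₁ x₂
    obtain ⟨V, hV⟩ := P.exists_isLyapunovFunction le_rfl hmono₀ hF hα hz hp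
    exact hV.globallyLyapunovStable le_rfl (P.continuous_flowField hF.continuous hα hz)
      (P.flowField_eq_zero hα hz hp)
  · obtain ⟨V, hV⟩ := P.exists_isLyapunovFunction hμ.le hstrong hF hα hz hp
    exact hV.globallyAsymptoticallyStable hμ (P.continuous_flowField hF.continuous hα hz)
      (P.flowField_eq_zero hα hz hp)

theorem mainTheorem2 {n m k : ℕ}
    (F : SafeMonotone.Vec n → SafeMonotone.Vec n)
    (g : Fin m → SafeMonotone.Vec n → ℝ)
    (H : Matrix (Fin k) (Fin n) ℝ) (c : Fin k → ℝ) (α : ℝ)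
    (hα : 0 < α)
    (hF : ContDiff ℝ 1 F)
    (hg : ∀ i, ContDiff ℝ 1 (g i))
    (hg' : ∀ i, LocallyLipschitz (gradient (g i)))
    (hconv : ∀ i, ConvexOn ℝ Set.univ (g i))
    (hMFCQ : ∀ x ∈ SafeMonotone.constraintSet g (SafeMonotone.affineConstraint H c),
      SafeMonotone.MFCQ g (SafeMonotone.affineConstraint H c) x)
    (hCR : ∀ x ∈ SafeMonotone.constraintSet g (SafeMonotone.affineConstraint H c),
      SafeMonotone.ConstantRank g (SafeMonotone.affineConstraint H c) x) :
    (SafeMonotone.IsMonotoneMap F →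
      ∀ xs ∈ SafeMonotone.SOL F
          (SafeMonotone.constraintSet g (SafeMonotone.affineConstraint H c)),
        SafeMonotone.GloballyLyapunovStable
          (SafeMonotone.safeMonotoneFlow F g (SafeMonotone.affineConstraint H c) α) xs) ∧
    (∀ μ : ℝ, 0 < μ → SafeMonotone.IsStronglyMonotoneMap μ F →
      ∀ xs ∈ SafeMonotone.SOL F
          (SafeMonotone.constraintSet g (SafeMonotone.affineConstraint H c)),
        SafeMonotone.GloballyAsymptoticallyStable
          (SafeMonotone.safeMonotoneFlow F g (SafeMonotone.affineConstraint H c) α) xs) := by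
  have P := SafeMonotone.isConvexSystem_affineConstraint
    (fun i => (hg i).differentiable one_ne_zero) hg' hconv H c
  exact mainTheorem2_general hα hF.locallyLipschitz P
    fun ⟨x, hx⟩ => P.exists_isSlaterPoint_of_MFCQ hx (hMFCQ x hx)
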